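/- Let $d\ge 2$ and let $\Omega\subset\mathbb R^d$ be a bounded Lipschitz domain, i.e. a bounded open set (not necessarily connected) which near each boundary point is, in suitable Cartesian coordinates, the region strictly below the graph of a Lipschitz function. For $\alpha\in\mathbb C$ let $$a_\alpha[u,v]=\int_\Omega \nabla u\cdot\overline{\nabla v}\,dx+\int_{\partial\Omega}\alpha\,\operatorname{tr}u\,\overline{\operatorname{tr}v}\,d\sigma,\qquad u,v\in H^1(\Omega;\mathbb C),$$ be the Robin form, where $\sigma$ is surface measure on $\partial\Omega$, let $W(a_\alpha)=\{a_\alpha[u,u]: u\in H^1(\Omega),\ \|u\|_{L^2(\Omega)}=1\}$ be its numerical range, and let $-\Delta_\Omega^\alpha$ be the Robin Laplacian, i.e. the operator in $L^2(\Omega)$ associated with $a_\alpha$: $u\in D(-\Delta_\Omega^\alpha)$ and $-\Delta_\Omega^\alpha u=h$ if and only if $u\in H^1(\Omega)$, $h\in L^2(\Omega)$ and $a_\alpha[u,v]=\int_\Omega h\overline v\,dx$ for all $v\in H^1(\Omega)$. Then there are constants $C_1\ge 2$ and $C_2>0$, depending only on $\Omega$, such that for every $\alpha\in\mathbb C$ $$W(a_\alpha)\subset\{\,t+\alpha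 s : t\ge 0,\ 0\le s\le C_1\sqrt t+C_2\,\},$$ and every $\lambda$ in the spectrum of $-\Delta_\Omega^\alpha$ (in particular every eigenvalue) satisfies $$\operatorname{Re}\lambda\ \ge\ -\frac{C_1^2}{4}|\operatorname{Re}\alpha|^2-C_2|\operatorname{Re}\alpha|.$$ If $\partial\Omega$ is of class $C^2$ (i.e. the functions above can be chosen $C^2$), then one may take $C_1=2$. -/

import Mathlib

open MeasureTheory Filter Topology
open scoped ContDiff ENNReal NNReal

noncomputable section

namespace RobinRange

/-! ### Sesquilinear forms on a Hilbert space and the operators associated with them -/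

section Abstract

variable {H : Type*} [NormedAddCommGroup H] [InnerProductSpace ℂ H]

/-- The numerical range `W(a) = {a[u,u] : u ∈ D, ‖u‖ = 1}` of a form `a` with domain `D`. -/
def formNumericalRange (D : Set H) (a : H → H → ℂ) : Set ℂ :=
  {z | ∃ u ∈ D, ‖u‖ = 1 ∧ z = a u u}

/-- The graph of the operator associated with a form `a` with domain `D`: the pairs `(u, h)` with
`u ∈ D` and `a[u,v] = (h,v)` for all `v ∈ D`, where `(h,v)` is linear in `h` and conjugate linear
in `v` (that is `inner ℂ v h` in Mathlib's convention). -/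
def formOperatorGraph (D : Set H) (a : H → H → ℂ) : Set (H × H) :=
  {p | p.1 ∈ D ∧ ∀ v ∈ D, a p.1 v = inner ℂ v p.2}

/-- The resolvent set of the (unbounded) operator `A` with graph `Γ`: those `z` for which there is
a bounded everywhere defined operator `R = (A - z)⁻¹`. Note that `A u - z u = f` says that
`(u, f + z u)` is in the graph. -/
def graphResolventSet (Γ : Set (H × H)) : Set ℂ :=
  {z | ∃ R : H →L[ℂ] H, ∀ u f : H, (u, f + z • u) ∈ Γ ↔ u = R f}

/-- The spectrum of the (unbounded) operator with graph `Γ`. -/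
def graphSpectrum (Γ : Set (H × H)) : Set ℂ := (graphResolventSet Γ)ᶜ

end Abstract

/-! ### Domains -/

/-- `ℝᵈ` with its Euclidean norm. -/
abbrev E (d : ℕ) : Type := EuclideanSpace ℝ (Fin d)

/-- Near every boundary point, in suitable Cartesian coordinates `(x', x_d)`, the set `Ω` is the
region `{x_d < g(x')}` strictly below the graph of a function `g : ℝᵈ⁻¹ → ℝ` of class `P`. For
continuous `g` the boundary of `Ω` is then locally the graph of `g`. -/
def LocallySubgraph {d : ℕ} (P : (E (d - 1) → ℝ) → Prop) (Ω : Set (E d)) : Prop :=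
  ∀ z ∈ frontier Ω, ∃ L : E d ≃ₗᵢ[ℝ] WithLp 2 (E (d - 1) × ℝ), ∃ U ∈ 𝓝 z,
    ∃ g : E (d - 1) → ℝ, P g ∧ ∀ x ∈ U, (x ∈ Ω ↔ (L x).snd < g (L x).fst)

/-- Bounded Lipschitz domain: a bounded open set whose boundary is locally the graph of a Lipschitz
function. Connectedness is not required (such a set has finitely many connected components). -/
structure IsBoundedLipschitzDomain {d : ℕ} (Ω : Set (E d)) : Prop where
  isOpen : IsOpen Ω
  isBounded : Bornology.IsBounded Ω
  lipschitz : LocallySubgraph (fun g => ∃ K : ℝ≥0, LipschitzWith K g) Ω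

/-- The boundary of `Ω` is of class `C²`: locally the graph of a `C²` function, with `Ω` on one
side of it. -/
def HasC2Boundary {d : ℕ} (Ω : Set (E d)) : Prop :=
  LocallySubgraph (fun g => ContDiff ℝ 2 g) Ω

/-- Lebesgue measure on `Ω`. -/
def vol {d : ℕ} (Ω : Set (E d)) : Measure (E d) := volume.restrict Ω

/-- Surface measure on `∂Ω`: the `(d-1)`-dimensional Hausdorff measure, normalised so as to agree
with Lebesgue measure on `ℝᵈ⁻¹`. -/
def surf {d : ℕ} (Ω : Set (E d)) : Measure (E d) :=
  (Measure.euclideanHausdorffMeasure (d - 1)).restrict (frontier Ω)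

/-! ### The Sobolev space `H¹(Ω)` and traces -/

/-- The gradient of a differentiable function `φ : ℝᵈ → ℂ`. -/
def grad {d : ℕ} (φ : E d → ℂ) (x : E d) : EuclideanSpace ℂ (Fin d) :=
  WithLp.toLp 2 fun i => fderiv ℝ φ x (EuclideanSpace.single i 1)

/-- `G ∈ L²(Ω; ℂᵈ)` is the weak gradient of `u` on `Ω`. -/
def IsWeakGrad {d : ℕ} (Ω : Set (E d)) (u : E d → ℂ) (G : E d → EuclideanSpace ℂ (Fin d)) : Prop :=
  MemLp G 2 (vol Ω) ∧
    ∀ η : E d → ℝ, ContDiff ℝ ∞ η → HasCompactSupport η → tsupport η ⊆ Ω → ∀ i : Fin d,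
      ∫ x, fderiv ℝ η x (EuclideanSpace.single i 1) • u x ∂(vol Ω) =
        -∫ x, η x • G x i ∂(vol Ω)

/-- `u ∈ H¹(Ω)`. -/
def MemH1 {d : ℕ} (Ω : Set (E d)) (u : E d → ℂ) : Prop :=
  MemLp u 2 (vol Ω) ∧ ∃ G, IsWeakGrad Ω u G

/-- The weak gradient of `u ∈ H¹(Ω)` (unique almost everywhere; an arbitrary function if
`u` has no weak gradient in `L²`). -/
def weakGrad {d : ℕ} (Ω : Set (E d)) (u : E d → ℂ) : E d → EuclideanSpace ℂ (Fin d) :=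
  Classical.epsilon (IsWeakGrad Ω u)

/-- `g ∈ L²(∂Ω)` is the trace of `u ∈ H¹(Ω)`: there are functions `φ n` in `C¹(ℝᵈ)` with
`φ n → u` in `H¹(Ω)` and `φ n → g` in `L²(∂Ω)`. -/
def IsTrace {d : ℕ} (Ω : Set (E d)) (u : E d → ℂ) (g : E d → ℂ) : Prop :=
  MemLp g 2 (surf Ω) ∧ ∃ φ : ℕ → E d → ℂ, (∀ n, ContDiff ℝ 1 (φ n)) ∧
    Tendsto (fun n => eLpNorm (fun x => φ n x - u x) 2 (vol Ω)) atTop (𝓝 0) ∧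
    Tendsto (fun n => eLpNorm (fun x => grad (φ n) x - weakGrad Ω u x) 2 (vol Ω)) atTop (𝓝 0) ∧
    Tendsto (fun n => eLpNorm (fun x => φ n x - g x) 2 (surf Ω)) atTop (𝓝 0)

/-- The trace of `u` on `∂Ω`. By the trace theorem, on a bounded Lipschitz domain every
`u ∈ H¹(Ω)` has a trace, and only one up to equality almost everywhere. (The value is an arbitrary
function where there is none.) -/
def trace {d : ℕ} (Ω : Set (E d)) (u : E d → ℂ) : E d → ℂ :=
  Classical.epsilon (IsTrace Ω u)

/-! ### The Robin form and the Robin Laplacian -/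

/-- The Hilbert space `L²(Ω)`. -/
abbrev L2 {d : ℕ} (Ω : Set (E d)) := Lp ℂ 2 (vol Ω)

/-- `H¹(Ω)` as a subset of `L²(Ω)`. -/
def H1 {d : ℕ} (Ω : Set (E d)) : Set (L2 Ω) := {u | MemH1 Ω u}

/-- The Robin form
`a_α[u,v] = ∫_Ω ∇u · conj (∇v) dx + ∫_∂Ω α (tr u) conj (tr v) dσ`, with domain `H¹(Ω)`. -/
def robinForm {d : ℕ} (Ω : Set (E d)) (α : ℂ) (u v : L2 Ω) : ℂ :=
  (∫ x, inner ℂ (weakGrad Ω v x) (weakGrad Ω u x) ∂(vol Ω)) +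
    ∫ x, α * trace Ω u x * (starRingEnd ℂ) (trace Ω v x) ∂(surf Ω)

/-- The numerical range `W(a_α)` of the Robin form. -/
def robinNumericalRange {d : ℕ} (Ω : Set (E d)) (α : ℂ) : Set ℂ :=
  formNumericalRange (H1 Ω) (robinForm Ω α)

/-- The spectrum of the Robin Laplacian, the operator on `L²(Ω)` associated with the Robin form. -/
def robinSpectrum {d : ℕ} (Ω : Set (E d)) (α : ℂ) : Set ℂ :=
  graphSpectrum (formOperatorGraph (H1 Ω) (robinForm Ω α))

/-- The parabolic-type region `{t + α s : t ≥ 0, 0 ≤ s ≤ C₁ √t + C₂}`. -/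
def parabolicRegion (C₁ C₂ : ℝ) (α : ℂ) : Set ℂ :=
  {z | ∃ t s : ℝ, 0 ≤ t ∧ 0 ≤ s ∧ s ≤ C₁ * √t + C₂ ∧ z = (t : ℂ) + α * (s : ℂ)}

end RobinRange

end

open MeasureTheory Filter Topology
open scoped ContDiff ENNReal NNReal

noncomputable section

namespace RobinRange

/-! ### The Lax–Milgram theorem for coercive operators -/

section LaxMilgram

variable {V : Type*} [NormedAddCommGroup V] [InnerProductSpace ℂ V]

/-! For `u ∈ H¹(Ω)` with `‖u‖ = 1` put `t = ‖∇u‖²` and `s = ‖tr u‖²`; then `a_α[u,u] = t + α s`. The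
inclusion for the numerical range is therefore the trace inequality `‖tr u‖² ≤ C₁ ‖u‖ ‖∇u‖ + C₂
‖u‖²`, whose constants do not involve `α`.

The trace inequality (`exists_traceInequality`) comes from the divergence theorem for `χ |φ|² N`,
where `χ` is a cutoff to a boundary chart and `N` a field whose flux density through the boundary
dominates surface measure. The product rule produces `2 χ |N| |φ| |∇φ|` plus a multiple of `|φ|²`,
so only the supremum of `|N|` enters `C₁`. Over a Lipschitz graph a constant vertical field works if
it is long enough to compensate the distortion of area. Over a `C²` graph the unit normal, extended
constantly in the vertical direction, is a `C¹` field of length one whose flux density is exactly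
the area density; this gives `C₁ = 2`. Gluing with a partition of unity does not enlarge the leading
constant, because `∑ χ ≤ 1`. Only upper bounds for the Hausdorff measure of graphs are needed.

For the spectrum, `Re (a_α[u,u] - z ‖u‖²)` is at least `‖∇u‖² - |Re α| (C₁ ‖∇u‖ ‖u‖ + C₂ ‖u‖²) - Re
z ‖u‖²`. This quadratic form in `(‖∇u‖, ‖u‖)` is positive definite when `Re z` lies below the
asserted bound, and Lax–Milgram then puts `z` in the resolvent set (`mem_graphResolventSet`).

The inequality is proved for `C¹(ℝᵈ)` functions. Its transfer to `H¹(Ω)` uses their density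
(`exists_contDiff_approx`), obtained by mollifying with kernels shifted so as to read values inside
`Ω` only, and the Hilbert space `tracedSobolev`, the closure of the triples `(φ, ∇φ, φ|_∂Ω)`. Each
`u ∈ H¹(Ω)` is the first entry of such a triple, and the other entries are its weak gradient and its
trace. -/

theorem le_norm_of_coercive {A : V →L[ℂ] V} {c : ℝ}
    (hA : ∀ p, c * ‖p‖ ^ 2 ≤ (inner ℂ p (A p)).re) (p : V) : c * ‖p‖ ≤ ‖A p‖ := by
  rcases eq_or_ne p 0 with rfl | hp
  · simp
  have hp' : 0 < ‖p‖ := norm_pos_iff.mpr hp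
  have h1 := hA p
  have h2 : (inner ℂ p (A p)).re ≤ ‖p‖ * ‖A p‖ :=
    (Complex.re_le_norm _).trans (norm_inner_le_norm _ _)
  have h3 : ‖p‖ * (c * ‖p‖) ≤ ‖p‖ * ‖A p‖ := by nlinarith
  exact le_of_mul_le_mul_left h3 hp'

/-- **Lax–Milgram**: a bounded operator with `c ‖p‖² ≤ Re ⟨p, A p⟩`, `c > 0`, is invertible. -/
theorem exists_equiv_of_coercive [CompleteSpace V] {A : V →L[ℂ] V} {c : ℝ} (hc : 0 < c)
    (hA : ∀ p, c * ‖p‖ ^ 2 ≤ (inner ℂ p (A p)).re) :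
    ∃ e : V ≃L[ℂ] V, (e : V →L[ℂ] V) = A := by
  have hanti : AntilipschitzWith (c⁻¹).toNNReal A := by
    refine A.antilipschitz_of_bound fun p => ?_
    rw [Real.coe_toNNReal _ (inv_nonneg.mpr hc.le), ← div_eq_inv_mul, le_div_iff₀ hc, mul_comm]
    exact le_norm_of_coercive hA p
  have hker : A.ker = ⊥ := LinearMap.ker_eq_bot.mpr hanti.injective
  have hcl : IsClosed (A.range : Set V) := hanti.isClosed_range A.uniformContinuous
  have hrange : A.range = ⊤ := by
    have := hcl.completeSpace_coe
    -- A vector `w` orthogonal to the closed range is orthogonal to `A w`, so coercivity forces `w =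
    -- 0`.
    rw [← A.range.orthogonal_orthogonal, Submodule.eq_top_iff']
    intro v w hw
    have h0 : inner ℂ (A w) w = 0 := hw _ ⟨w, rfl⟩
    have h1 := hA w
    rw [← inner_conj_symm, h0] at h1
    have h2 : ‖w‖ = 0 := by
      by_contra h
      have : 0 < ‖w‖ := lt_of_le_of_ne (norm_nonneg _) (Ne.symm h)
      have : 0 < c * ‖w‖ ^ 2 := by positivity
      simp at h1
      linarith
    rw [norm_eq_zero.mp h2]
    exact inner_zero_left _
  exact ⟨ContinuousLinearEquiv.ofBijective A hker hrange, ContinuousLinearEquiv.coe_ofBijective ..⟩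

end LaxMilgram

/-- The quadratic form `x² - a (C₁ x y + C₂ y²) + w y²` is positive definite as soon as
`C₁² a² / 4 + C₂ a < w`. -/
theorem exists_pos_quadratic_lower_bound {C₁ C₂ a w : ℝ} (h : C₁ ^ 2 / 4 * a ^ 2 + C₂ * a < w) :
    ∃ c > 0, ∀ x y : ℝ, c * (x ^ 2 + y ^ 2) ≤ x ^ 2 - a * (C₁ * (x * y) + C₂ * y ^ 2) + w * y ^ 2 := by
  set m := a * C₁ / 2 with hm
  set δ := w - (C₁ ^ 2 / 4 * a ^ 2 + C₂ * a) with hδ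
  have hδ0 : 0 < δ := by rw [hδ]; linarith
  have hD : 0 < 2 * m ^ 2 + 1 := by positivity
  -- Completing the square turns the form into `(x - m y)² + δ y²`. Since `x² ≤ 2 (x - m y)² + 2 m²
  -- y²`, it suffices that `2 c ≤ 1` and `c (2 m² + 1) ≤ δ`.
  refine ⟨min (1 / 2) (δ / (2 * m ^ 2 + 1)), by positivity, fun x y => ?_⟩
  set c := min (1 / 2) (δ / (2 * m ^ 2 + 1)) with hc
  have hc0 : 0 ≤ c := by positivity
  have h1 : 2 * c ≤ 1 := by have := min_le_left (1 / 2 : ℝ) (δ / (2 * m ^ 2 + 1)); linarith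
  have h2 : c * (2 * m ^ 2 + 1) ≤ δ := by
    have := min_le_right (1 / 2 : ℝ) (δ / (2 * m ^ 2 + 1))
    rwa [le_div_iff₀ hD] at this
  have e : x ^ 2 - a * (C₁ * (x * y) + C₂ * y ^ 2) + w * y ^ 2 = (x - m * y) ^ 2 + δ * y ^ 2 := by
    rw [hm, hδ]; ring
  rw [e]
  have h3 : c * x ^ 2 ≤ c * (2 * (x - m * y) ^ 2 + 2 * m ^ 2 * y ^ 2) :=
    mul_le_mul_of_nonneg_left (by nlinarith [sq_nonneg (x - 2 * m * y)]) hc0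
  nlinarith [mul_le_mul_of_nonneg_right h1 (sq_nonneg (x - m * y)),
    mul_le_mul_of_nonneg_right h2 (sq_nonneg y)]

/-! ### Hausdorff measure of graphs -/

section GraphMeasure

open scoped RealInnerProductSpace

variable {n : ℕ}

/-- The parametrisation `x ↦ (x, g x)` of the graph of `g`. -/
def graphMap (g : E n → ℝ) (x : E n) : WithLp 2 (E n × ℝ) := WithLp.toLp 2 (x, g x)

@[simp] theorem graphMap_fst (g : E n → ℝ) (x : E n) : (graphMap g x).fst = x := rfl

@[simp] theorem graphMap_snd (g : E n → ℝ) (x : E n) : (graphMap g x).snd = g x := rfl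

theorem continuous_graphMap {g : E n → ℝ} (hg : Continuous g) : Continuous (graphMap g) := by
  unfold graphMap
  fun_prop

theorem euclideanHausdorffMeasure_image_le {X Y : Type*} [MetricSpace X] [MeasurableSpace X]
    [BorelSpace X] [MetricSpace Y] [MeasurableSpace Y] [BorelSpace Y] {K : ℝ≥0} {f : X → Y}
    {s : Set X} (hf : LipschitzOnWith K f s) (m : ℕ) :
    Measure.euclideanHausdorffMeasure m (f '' s) ≤
      (K : ℝ≥0∞) ^ m * Measure.euclideanHausdorffMeasure m s := by
  rw [Measure.euclideanHausdorffMeasure_def, Measure.euclideanHausdorffMeasure_def,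
    Measure.smul_apply, Measure.smul_apply, ENNReal.smul_def, ENNReal.smul_def, smul_eq_mul,
    smul_eq_mul, mul_left_comm]
  gcongr
  simpa using hf.hausdorffMeasure_image_le (d := m) (Nat.cast_nonneg m)

/-- The symmetric square root of `1 + a aᵀ`. -/
def shear (a : E n) : E n →ₗ[ℝ] E n :=
  LinearMap.transvection (innerₗ (E n) a) ((1 + √(1 + ‖a‖ ^ 2))⁻¹ • a)

theorem shear_apply (a v : E n) :
    shear a v = v + (⟪a, v⟫ * (1 + √(1 + ‖a‖ ^ 2))⁻¹) • a := by
  simp [shear, LinearMap.transvection.apply, smul_smul]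

/-- With `c = √(1 + ‖a‖²)` the transvection has determinant `1 + ‖a‖² / (1 + c)`, and `‖a‖² = (c -
1)(c + 1)`. This is the area factor of a plane of slope `a`. -/
theorem det_shear (a : E n) : LinearMap.det (shear a) = √(1 + ‖a‖ ^ 2) := by
  rw [shear, LinearMap.transvection.det]
  simp only [map_smul, innerₗ_apply_apply, smul_eq_mul, real_inner_self_eq_norm_sq]
  have h : √(1 + ‖a‖ ^ 2) ^ 2 = 1 + ‖a‖ ^ 2 := Real.sq_sqrt (by positivity)
  have h0 : 0 ≤ √(1 + ‖a‖ ^ 2) := Real.sqrt_nonneg _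
  field_simp
  linarith

/-- The right-hand side is the squared length of `(v, ⟪a, v⟫)`, so `shear a` makes the
parametrisation of the plane isometric. -/
theorem norm_shear_sq (a v : E n) : ‖shear a v‖ ^ 2 = ‖v‖ ^ 2 + ⟪a, v⟫ ^ 2 := by
  rw [shear_apply, norm_add_sq_real, norm_smul, inner_smul_right, real_inner_comm, mul_pow,
    Real.norm_eq_abs, sq_abs]
  have h : ‖a‖ ^ 2 = √(1 + ‖a‖ ^ 2) ^ 2 - 1 := by rw [Real.sq_sqrt (by positivity)]; ring
  have h0 : 0 ≤ √(1 + ‖a‖ ^ 2) := Real.sqrt_nonneg _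
  set c := √(1 + ‖a‖ ^ 2)
  rw [h]
  field_simp
  ring

/-- The piece of plane over `A` is an isometric copy of `shear a '' A`, whose volume is read off
from the determinant. -/
theorem euclideanHausdorffMeasure_graphMap_inner_image (a : E n) (A : Set (E n)) :
    Measure.euclideanHausdorffMeasure n (graphMap (fun v => ⟪a, v⟫) '' A) =
      ENNReal.ofReal √(1 + ‖a‖ ^ 2) * volume A := by
  have hdet : LinearMap.det (shear a) ≠ 0 := by
    rw [det_shear]
    have : 0 < √(1 + ‖a‖ ^ 2) := Real.sqrt_pos.mpr (by positivity)
    exact this.ne'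
  let e : E n ≃ₗ[ℝ] E n := (shear a).equivOfDetNeZero hdet
  have he : ∀ v, e v = shear a v := fun v => rfl
  have hiso : Isometry (fun w => graphMap (fun v => ⟪a, v⟫) (e.symm w)) := by
    refine Isometry.of_dist_eq fun w₁ w₂ => ?_
    obtain ⟨v₁, rfl⟩ := e.surjective w₁
    obtain ⟨v₂, rfl⟩ := e.surjective w₂
    simp only [LinearEquiv.symm_apply_apply]
    rw [dist_eq_norm, dist_eq_norm, ← map_sub, he, ← sq_eq_sq₀ (norm_nonneg _) (norm_nonneg _),
      norm_shear_sq, WithLp.prod_norm_sq_eq_of_L2]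
    simp [graphMap, inner_sub_right]
  have himg : graphMap (fun v => ⟪a, v⟫) '' A =
      (fun w => graphMap (fun v => ⟪a, v⟫) (e.symm w)) '' (shear a '' A) := by
    rw [Set.image_image]
    refine Set.image_congr fun v _ => ?_
    rw [← he, LinearEquiv.symm_apply_apply]
  rw [himg, hiso.euclideanHausdorffMeasure_image, EuclideanSpace.euclideanHausdorffMeasure_eq_volume,
    Measure.addHaar_image_linearMap, det_shear, abs_of_nonneg (Real.sqrt_nonneg _)]

theorem norm_le_norm_withLp (p : WithLp 2 (E n × ℝ)) : ‖p.fst‖ ≤ ‖p‖ := by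
  rw [← sq_le_sq₀ (norm_nonneg _) (norm_nonneg _), WithLp.prod_norm_sq_eq_of_L2]
  nlinarith [sq_nonneg ‖p.snd‖]

theorem norm_withLp_le_add (p : WithLp 2 (E n × ℝ)) : ‖p‖ ≤ ‖p.fst‖ + ‖p.snd‖ := by
  rw [← sq_le_sq₀ (norm_nonneg _) (by positivity), WithLp.prod_norm_sq_eq_of_L2]
  nlinarith [norm_nonneg p.fst, norm_nonneg p.snd]

/-- The parametrisation `graphMap g` is `(1 + K)`-Lipschitz. The crude constant suffices, as `C₁` is
unspecified for Lipschitz domains. -/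
theorem euclideanHausdorffMeasure_graphMap_image_le_of_lipschitz {g : E n → ℝ} {K : ℝ≥0}
    (hg : LipschitzWith K g) (A : Set (E n)) :
    Measure.euclideanHausdorffMeasure n (graphMap g '' A) ≤
      ((1 + K : ℝ≥0) : ℝ≥0∞) ^ n * volume A := by
  rw [← EuclideanSpace.euclideanHausdorffMeasure_eq_volume]
  refine euclideanHausdorffMeasure_image_le (LipschitzWith.lipschitzOnWith ?_) n
  refine LipschitzWith.of_dist_le_mul fun x y => ?_
  rw [dist_eq_norm]
  refine (norm_withLp_le_add _).trans ?_
  have := hg.dist_le_mul x y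
  rw [dist_eq_norm, dist_eq_norm] at this
  simp only [WithLp.sub_fst, WithLp.sub_snd, graphMap_fst, graphMap_snd, dist_eq_norm]
  push_cast
  linarith

/-- Locally, the measure of a `C¹` graph is controlled by that of a tangent plane. -/
theorem exists_nhds_euclideanHausdorffMeasure_graphMap_image_le {g : E n → ℝ}
    (hg : ContDiff ℝ 1 g) (x₀ : E n) {δ : ℝ≥0} (hδ : 0 < δ) :
    ∃ U ∈ 𝓝 x₀, ∀ A ⊆ U, Measure.euclideanHausdorffMeasure n (graphMap g '' A) ≤
      ((1 + δ : ℝ≥0) : ℝ≥0∞) ^ n * (ENNReal.ofReal √(1 + ‖gradient g x₀‖ ^ 2) * volume A) := by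
  have hs : HasStrictFDerivAt g (fderiv ℝ g x₀) x₀ :=
    hg.contDiffAt.hasStrictFDerivAt one_ne_zero
  obtain ⟨U, hU, hlip⟩ := hs.approximates_deriv_on_nhds (c := δ) (Or.inr hδ)
  refine ⟨U, hU, fun A hA => ?_⟩
  set a := gradient g x₀ with ha
  have hga : ∀ v, fderiv ℝ g x₀ v = ⟪a, v⟫ := fun v => by
    rw [ha, gradient, InnerProductSpace.toDual_symm_apply]
  rw [← euclideanHausdorffMeasure_graphMap_inner_image]
  -- The curved graph is the image of its tangent plane under vertical projection, which is `(1 +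
  -- δ)`-Lipschitz because `g` is strictly differentiable at `x₀`.
  have himg : graphMap g '' A = (fun p : WithLp 2 (E n × ℝ) => graphMap g p.fst) ''
      (graphMap (fun v => ⟪a, v⟫) '' A) := by
    rw [Set.image_image]
    rfl
  rw [himg]
  refine euclideanHausdorffMeasure_image_le ?_ n
  refine LipschitzOnWith.of_dist_le_mul ?_
  rintro _ ⟨x, hx, rfl⟩ _ ⟨y, hy, rfl⟩
  rw [dist_eq_norm, dist_eq_norm]
  set p := graphMap (fun v => ⟪a, v⟫) x - graphMap (fun v => ⟪a, v⟫) y with hp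
  have hp1 : p.fst = x - y := by simp [hp]
  have hp2 : p.snd = ⟪a, x - y⟫ := by simp [hp, inner_sub_right]
  have hsplit : graphMap g (graphMap (fun v => ⟪a, v⟫) x).fst -
      graphMap g (graphMap (fun v => ⟪a, v⟫) y).fst =
      p + WithLp.toLp 2 ((0 : E n), g x - g y - ⟪a, x - y⟫) := by
    rw [hp]
    refine WithLp.ofLp_injective 2 (Prod.ext ?_ ?_) <;> simp [graphMap, inner_sub_right]
  have hl := hlip x (hA hx) y (hA hy)
  rw [hga] at hl
  have h2 : ‖WithLp.toLp 2 ((0 : E n), g x - g y - ⟪a, x - y⟫)‖ ≤ δ * ‖p‖ := by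
    refine (norm_withLp_le_add _).trans ?_
    rw [WithLp.toLp_fst, WithLp.toLp_snd, norm_zero, zero_add]
    refine hl.trans ?_
    gcongr
    rw [← hp1]
    exact norm_le_norm_withLp p
  rw [hsplit]
  refine (norm_add_le _ _).trans ?_
  push_cast
  linarith

theorem continuous_gradient {g : E n → ℝ} (hg : ContDiff ℝ 1 g) : Continuous (gradient g) :=
  (InnerProductSpace.toDual ℝ (E n)).symm.continuous.comp (hg.continuous_fderiv one_ne_zero)

/-- The area of a `C¹` graph is at most the integral of `√(1 + |∇g|²)`. -/
theorem euclideanHausdorffMeasure_graphMap_image_le {g : E n → ℝ} (hg : ContDiff ℝ 1 g)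
    {A : Set (E n)} (hA : MeasurableSet A) :
    Measure.euclideanHausdorffMeasure n (graphMap g '' A) ≤
      ∫⁻ x in A, ENNReal.ofReal √(1 + ‖gradient g x‖ ^ 2) := by
  set w : E n → ℝ := fun x => √(1 + ‖gradient g x‖ ^ 2) with hw
  have hwc : Continuous w := by
    have := continuous_gradient hg
    fun_prop
  have hw0 : ∀ x, 0 < w x := fun x => Real.sqrt_pos.mpr (by positivity)
  -- Of the `n + 1` factors, `n` come from the Lipschitz distortion of the tangent plane and one
  -- from replacing `w x₀` by `w x` nearby.
  have key : ∀ δ : ℝ≥0, 0 < δ → Measure.euclideanHausdorffMeasure n (graphMap g '' A) ≤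
      ((1 + δ : ℝ≥0) : ℝ≥0∞) ^ (n + 1) * ∫⁻ x in A, ENNReal.ofReal (w x) := by
    intro δ hδ
    have hloc : ∀ x₀, ∃ U ∈ 𝓝 x₀, ∀ B ⊆ U, MeasurableSet B →
        Measure.euclideanHausdorffMeasure n (graphMap g '' B) ≤
          ((1 + δ : ℝ≥0) : ℝ≥0∞) ^ (n + 1) * ∫⁻ x in B, ENNReal.ofReal (w x) := by
      intro x₀
      obtain ⟨U, hU, h⟩ := exists_nhds_euclideanHausdorffMeasure_graphMap_image_le hg x₀ hδ
      have hlt : w x₀ < (1 + δ) * w x₀ := by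
        have := hw0 x₀
        have hδ' : (0 : ℝ) < δ := hδ
        nlinarith
      have hev : ∀ᶠ x in 𝓝 x₀, w x₀ < (1 + δ) * w x :=
        continuousAt_const.eventually_lt (continuousAt_const.mul hwc.continuousAt) hlt
      refine ⟨U ∩ {x | w x₀ < (1 + δ) * w x}, inter_mem hU hev, fun B hB hBm => ?_⟩
      refine (h B (hB.trans Set.inter_subset_left)).trans ?_
      rw [pow_succ _ n, mul_assoc]
      refine mul_le_mul_right ?_ _
      rw [← lintegral_const_mul' _ _ ENNReal.coe_ne_top, ← setLIntegral_const]
      refine setLIntegral_mono (by fun_prop) fun x hx => ?_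
      rw [← ENNReal.ofReal_coe_nnreal, ← ENNReal.ofReal_mul (by positivity)]
      refine ENNReal.ofReal_le_ofReal ?_
      push_cast
      exact (hB hx).2.le
    choose U hU hUle using hloc
    -- Countably many of the neighbourhoods suffice; they are made disjoint so that the integrals
    -- over the pieces add up exactly.
    obtain ⟨s, hs, hsU⟩ := TopologicalSpace.countable_cover_nhds fun x => interior_mem_nhds.mpr (hU x)
    rcases s.eq_empty_or_nonempty with rfl | hne
    · have : (A : Set (E n)) = ∅ := by
        rw [← Set.univ_inter A, ← hsU]; simp
      simp [this]
    obtain ⟨x, hx⟩ := hs.exists_eq_range hne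
    set O : ℕ → Set (E n) := fun k => interior (U (x k)) with hO
    have hOU : ⋃ k, O k = Set.univ := by
      rw [← hsU, hx, Set.biUnion_range]
    have hOm : ∀ k, MeasurableSet (disjointed O k) := fun k =>
      MeasurableSet.disjointed (fun k => isOpen_interior.measurableSet) k
    have hAeq : A = ⋃ k, A ∩ disjointed O k := by
      rw [← Set.inter_iUnion, iUnion_disjointed, hOU, Set.inter_univ]
    calc Measure.euclideanHausdorffMeasure n (graphMap g '' A)
        = Measure.euclideanHausdorffMeasure n (⋃ k, graphMap g '' (A ∩ disjointed O k)) := by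
          rw [← Set.image_iUnion, ← hAeq]
      _ ≤ ∑' k, Measure.euclideanHausdorffMeasure n (graphMap g '' (A ∩ disjointed O k)) :=
          measure_iUnion_le _
      _ ≤ ∑' k, ((1 + δ : ℝ≥0) : ℝ≥0∞) ^ (n + 1) *
            ∫⁻ x in A ∩ disjointed O k, ENNReal.ofReal (w x) := by
          refine ENNReal.tsum_le_tsum fun k => hUle (x k) _ ?_ (hA.inter (hOm k))
          exact Set.inter_subset_right.trans ((disjointed_subset O k).trans interior_subset)
      _ = ((1 + δ : ℝ≥0) : ℝ≥0∞) ^ (n + 1) * ∫⁻ x in A, ENNReal.ofReal (w x) := by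
          rw [ENNReal.tsum_mul_left]
          congr 1
          conv_rhs => rw [hAeq]
          rw [lintegral_iUnion (fun k => hA.inter (hOm k))]
          exact fun i j hij => ((disjoint_disjointed O) hij).mono Set.inter_subset_right
            Set.inter_subset_right
  have hlim : Tendsto (fun δ : ℝ≥0 => ((1 + δ : ℝ≥0) : ℝ≥0∞) ^ (n + 1) *
      ∫⁻ x in A, ENNReal.ofReal (w x)) (𝓝[>] 0) (𝓝 (∫⁻ x in A, ENNReal.ofReal (w x))) := by
    have h1 : Tendsto (fun δ : ℝ≥0 => ((1 + δ : ℝ≥0) : ℝ≥0∞) ^ (n + 1)) (𝓝[>] 0) (𝓝 1) := by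
      have : Continuous fun δ : ℝ≥0 => (((1 + δ) ^ (n + 1) : ℝ≥0) : ℝ≥0∞) :=
        ENNReal.continuous_coe.comp (by fun_prop)
      have h := this.tendsto 0
      simp only [add_zero, one_pow, ENNReal.coe_one, ENNReal.coe_pow] at h
      exact h.mono_left nhdsWithin_le_nhds
    have := ENNReal.Tendsto.mul_const (b := ∫⁻ x in A, ENNReal.ofReal (w x)) h1 (Or.inl one_ne_zero)
    rwa [one_mul] at this
  refine ge_of_tendsto hlim ?_
  filter_upwards [self_mem_nhdsWithin] with δ hδ using key δ hδ

/-- Integration over a (rotated) graph is controlled by integration over its base. -/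
theorem setLIntegral_euclideanHausdorffMeasure_graph_le {X : Type*} [MetricSpace X]
    [MeasurableSpace X] [BorelSpace X] {L : WithLp 2 (E n × ℝ) → X} (hL : Isometry L)
    {g : E n → ℝ} (hg : Continuous g) {w : E n → ℝ≥0∞} (hw : Measurable w)
    (hgw : ∀ A, MeasurableSet A →
      Measure.euclideanHausdorffMeasure n (graphMap g '' A) ≤ ∫⁻ x in A, w x)
    {s : Set X} (hs : s ⊆ Set.range fun x => L (graphMap g x)) {h : X → ℝ≥0∞} (hh : Measurable h) :
    ∫⁻ y in s, h y ∂(Measure.euclideanHausdorffMeasure n) ≤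
      ∫⁻ x, w x * h (L (graphMap g x)) := by
  have hΦ : Measurable fun x => L (graphMap g x) :=
    (hL.continuous.comp (continuous_graphMap hg)).measurable
  -- Applied to every measurable base, `hgw` bounds the surface measure by the pushforward of `w
  -- dx`.
  have hle : (Measure.euclideanHausdorffMeasure n).restrict s ≤
      Measure.map (fun x => L (graphMap g x)) (volume.withDensity w) := by
    refine Measure.le_iff.mpr fun B hB => ?_
    rw [Measure.restrict_apply hB, Measure.map_apply hΦ hB, withDensity_apply _ (hΦ hB)]
    refine le_trans ?_ (hgw _ (hΦ hB))
    rw [← hL.euclideanHausdorffMeasure_image]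
    refine measure_mono fun y hy => ?_
    obtain ⟨x, rfl⟩ := hs hy.2
    exact ⟨_, ⟨x, hy.1, rfl⟩, rfl⟩
  calc ∫⁻ y in s, h y ∂(Measure.euclideanHausdorffMeasure n)
      ≤ ∫⁻ y, h y ∂(Measure.map (fun x => L (graphMap g x)) (volume.withDensity w)) :=
        lintegral_mono' hle le_rfl
    _ = ∫⁻ x, w x * h (L (graphMap g x)) := by
        rw [lintegral_map hh hΦ]
        exact lintegral_withDensity_eq_lintegral_mul _ hw (hh.comp hΦ)

end GraphMeasure

/-! ### The divergence theorem on subgraphs -/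

section Subgraph

variable {n : ℕ}

/-- The region strictly below the graph of `g`. -/
def subgraph (g : E n → ℝ) : Set (E n × ℝ) := {p | p.2 < g p.1}

theorem isOpen_subgraph {g : E n → ℝ} (hg : Continuous g) : IsOpen (subgraph g) :=
  isOpen_lt continuous_snd (hg.comp continuous_fst)

/-- Fubini, and the fundamental theorem of calculus on each vertical half-line. Differentiability is
asked only vertically, because the lemma is later applied to a product with `fderiv ℝ g p.1 v`,
which is merely continuous in the horizontal variable. -/
theorem setIntegral_subgraph_of_hasDerivAt {g : E n → ℝ} (hg : Continuous g)
    {f f' : E n × ℝ → ℝ} (hf : HasCompactSupport f) (hf'c : Continuous f')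
    (hf' : HasCompactSupport f')
    (hd : ∀ x y, HasDerivAt (fun y => f (x, y)) (f' (x, y)) y) :
    ∫ p in subgraph g, f' p = ∫ x, f (x, g x) := by
  have hint : Integrable ((subgraph g).indicator f') (volume.prod volume) :=
    (hf'c.integrable_of_hasCompactSupport hf').indicator (isOpen_subgraph hg).measurableSet
  rw [← integral_indicator (isOpen_subgraph hg).measurableSet, Measure.volume_eq_prod,
    integral_prod _ hint]
  refine integral_congr_ae (Eventually.of_forall fun x => ?_)
  have h1 : (fun y => (subgraph g).indicator f' (x, y)) =
      (Set.Iio (g x)).indicator fun y => f' (x, y) := by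
    ext y
    by_cases h : y < g x <;> simp [Set.indicator, subgraph, h]
  have hderiv : deriv (fun y => f (x, y)) = fun y => f' (x, y) := funext fun y => (hd x y).deriv
  have hC : ContDiff ℝ 1 fun y => f (x, y) := by
    rw [contDiff_one_iff_deriv, hderiv]
    exact ⟨fun y => (hd x y).differentiableAt, by fun_prop⟩
  have hK : HasCompactSupport fun y => f (x, y) :=
    hf.comp_isClosedEmbedding (Topology.IsClosedEmbedding.of_continuous_injective_isClosedMap
      (by fun_prop) (fun a b h => by simpa using h) (isClosedMap_prodMk_left x))
  have h2 := HasCompactSupport.integral_Iic_deriv_eq hC hK (g x)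
  simp only
  rw [h1, integral_indicator measurableSet_Iio, ← integral_Iic_eq_integral_Iio, ← h2, hderiv]

/-- Fundamental theorem of calculus in the vertical direction. -/
theorem setIntegral_subgraph_fderiv_vertical {g : E n → ℝ} (hg : Continuous g)
    {f : E n × ℝ → ℝ} (hf : ContDiff ℝ 1 f) (hfc : HasCompactSupport f) :
    ∫ p in subgraph g, fderiv ℝ f p (0, 1) = ∫ x, f (x, g x) := by
  refine setIntegral_subgraph_of_hasDerivAt hg hfc
    ((hf.continuous_fderiv one_ne_zero).clm_apply continuous_const) (hfc.fderiv_apply ℝ _)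
    fun x y => ?_
  have h := (hf.differentiable one_ne_zero (x, y)).hasFDerivAt.comp_hasDerivAt y
    ((hasDerivAt_const y x).prodMk (hasDerivAt_id y))
  exact h

theorem integral_fderiv_apply_eq_zero {F : Type*} [NormedAddCommGroup F] [NormedSpace ℝ F]
    [MeasurableSpace F] [BorelSpace F] [FiniteDimensional ℝ F] {μ : Measure F} [μ.IsAddHaarMeasure]
    {f : F → ℝ} (hf : ContDiff ℝ 1 f) (hfc : HasCompactSupport f) (v : F) :
    ∫ x, fderiv ℝ f x v ∂μ = 0 := by
  have h := integral_mul_fderiv_eq_neg_fderiv_mul_of_integrable (μ := μ) (f := fun _ : F => (1 : ℝ))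
    (g := f) (v := v) (by simp) ?_ ?_ (by simp) fun x _ => hf.differentiable one_ne_zero x
  · simpa using h
  · simpa using ((hf.continuous_fderiv one_ne_zero).clm_apply
      continuous_const).integrable_of_hasCompactSupport (hfc.fderiv_apply ℝ v)
  · simpa using hf.continuous.integrable_of_hasCompactSupport hfc

/-- The shear `(x, y) ↦ (x, y + g x)`, flattening the graph of `g`. -/
def flatten (g : E n → ℝ) (hg : Continuous g) : (E n × ℝ) ≃ₜ (E n × ℝ) where
  toFun p := (p.1, p.2 + g p.1)
  invFun p := (p.1, p.2 - g p.1)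
  left_inv p := by simp
  right_inv p := by simp
  continuous_toFun := by fun_prop
  continuous_invFun := by fun_prop

theorem measurePreserving_flatten (g : E n → ℝ) (hg : Continuous g) :
    MeasurePreserving (flatten g hg) := by
  rw [Measure.volume_eq_prod]
  refine MeasurePreserving.skew_product (g := fun x y => y + g x) (MeasurePreserving.id _)
    (by fun_prop) (Eventually.of_forall fun x => ?_)
  exact (measurePreserving_add_right volume (g x)).map_eq

/-- Integration by parts in a horizontal direction. -/
theorem setIntegral_subgraph_fderiv_horizontal {g : E n → ℝ} (hg : ContDiff ℝ 1 g)
    {f : E n × ℝ → ℝ} (hf : ContDiff ℝ 1 f) (hfc : HasCompactSupport f) (v : E n) :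
    ∫ p in subgraph g, fderiv ℝ f p (v, 0) = -∫ x, fderiv ℝ g x v * f (x, g x) := by
  -- In flattened coordinates the horizontal derivative of `f` is that of `h = f ∘ T` minus the
  -- slope of `g` times the vertical derivative of `h`. The first term integrates to zero over every
  -- horizontal slice; the second is evaluated by the fundamental theorem of calculus.
  set T := flatten g hg.continuous with hT
  have hTC : ContDiff ℝ 1 T := by
    change ContDiff ℝ 1 fun p : E n × ℝ => (p.1, p.2 + g p.1)
    fun_prop
  set h : E n × ℝ → ℝ := f ∘ T with hh
  have hhC : ContDiff ℝ 1 h := hf.comp hTC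
  have hhc : HasCompactSupport h := hfc.comp_homeomorph T
  have hTd : ∀ p : E n × ℝ, HasFDerivAt T ((ContinuousLinearMap.fst ℝ (E n) ℝ).prod
      (ContinuousLinearMap.snd ℝ (E n) ℝ + (fderiv ℝ g p.1).comp
        (ContinuousLinearMap.fst ℝ (E n) ℝ))) p := fun p =>
    hasFDerivAt_fst.prodMk (hasFDerivAt_snd.add
      ((hg.differentiable one_ne_zero p.1).hasFDerivAt.comp p hasFDerivAt_fst))
  have hhd : ∀ p w, fderiv ℝ h p w = fderiv ℝ f (T p) (w.1, w.2 + fderiv ℝ g p.1 w.1) := by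
    intro p w
    rw [hh, ((hf.differentiable one_ne_zero (T p)).hasFDerivAt.comp p (hTd p)).fderiv]
    simp
  have hgc : Continuous fun p : E n × ℝ => fderiv ℝ g p.1 v :=
    ((hg.continuous_fderiv one_ne_zero).comp continuous_fst).clm_apply continuous_const
  have hcont : ∀ w, Continuous fun p => fderiv ℝ h p w := fun w =>
    (hhC.continuous_fderiv one_ne_zero).clm_apply continuous_const
  have hvert : ∫ p in subgraph (fun _ : E n => (0 : ℝ)), fderiv ℝ g p.1 v * fderiv ℝ h p (0, 1) =
      ∫ x, fderiv ℝ g x v * f (x, g x) := by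
    have := setIntegral_subgraph_of_hasDerivAt (g := fun _ : E n => (0 : ℝ))
      (f := fun p => fderiv ℝ g p.1 v * h p) (f' := fun p => fderiv ℝ g p.1 v * fderiv ℝ h p (0, 1))
      continuous_const hhc.mul_left (hgc.mul (hcont _)) (hhc.fderiv_apply ℝ _).mul_left
      fun x y => HasDerivAt.const_mul (fderiv ℝ g x v)
        ((hhC.differentiable one_ne_zero (x, y)).hasFDerivAt.comp_hasDerivAt y
        ((hasDerivAt_const y x).prodMk (hasDerivAt_id y)))
    rw [this]
    simp [hh, hT, flatten]
  have hhor : ∫ p in subgraph (fun _ : E n => (0 : ℝ)), fderiv ℝ h p (v, 0) = 0 := by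
    have hint : Integrable ((subgraph fun _ : E n => (0 : ℝ)).indicator
        fun p => fderiv ℝ h p (v, 0)) (volume.prod volume) :=
      ((hcont _).integrable_of_hasCompactSupport (hhc.fderiv_apply ℝ _)).indicator
        (isOpen_subgraph continuous_const).measurableSet
    rw [← integral_indicator (isOpen_subgraph continuous_const).measurableSet,
      Measure.volume_eq_prod, integral_prod_symm _ hint]
    refine integral_eq_zero_of_ae (Eventually.of_forall fun y => ?_)
    by_cases hy : y < 0
    · have hs : ∀ x : E n, fderiv ℝ (fun x => h (x, y)) x v = fderiv ℝ h (x, y) (v, 0) := by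
        intro x
        have h1 : HasFDerivAt (fun x : E n => (x, y)) ((ContinuousLinearMap.id ℝ (E n)).prod 0) x :=
          (hasFDerivAt_id x).prodMk (hasFDerivAt_const y x)
        have h2 : HasFDerivAt (fun x => h (x, y)) _ x :=
          (hhC.differentiable one_ne_zero (x, y)).hasFDerivAt.comp (g := h) x h1
        rw [h2.fderiv]
        simp
      have hK : HasCompactSupport fun x => h (x, y) :=
        hhc.comp_isClosedEmbedding (Topology.IsClosedEmbedding.of_continuous_injective_isClosedMap
          (by fun_prop) (fun a b h => by simpa using h) (isClosedMap_prodMk_right y))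
      simp only [Set.indicator, subgraph, Set.mem_ofPred_eq, hy, if_true, ← hs]
      exact integral_fderiv_apply_eq_zero (hhC.comp (by fun_prop)) hK v
    · simp [Set.indicator, subgraph, hy]
  have hchange : ∫ p in subgraph g, fderiv ℝ f p (v, 0) =
      ∫ p in subgraph (fun _ : E n => (0 : ℝ)), fderiv ℝ f (T p) (v, 0) := by
    rw [← (measurePreserving_flatten g hg.continuous).setIntegral_preimage_emb
      (flatten g hg.continuous).measurableEmbedding]
    congr 2
    ext p
    simp [subgraph, flatten]
  have hsplit : ∀ p, fderiv ℝ f (T p) (v, 0) =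
      fderiv ℝ h p (v, 0) - fderiv ℝ g p.1 v * fderiv ℝ h p (0, 1) := by
    intro p
    rw [hhd, hhd, ← smul_eq_mul, ← map_smul, ← map_sub]
    simp
  rw [hchange, integral_congr_ae (Eventually.of_forall hsplit), integral_sub, hhor, hvert, zero_sub]
  · exact ((hcont _).integrable_of_hasCompactSupport (hhc.fderiv_apply ℝ _)).integrableOn
  · exact ((hgc.mul (hcont _)).integrable_of_hasCompactSupport
      (hhc.fderiv_apply ℝ _).mul_left).integrableOn

/-- The upward unit normal to the graph of `g`, extended constantly in the vertical direction. -/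
def graphNormal (g : E n → ℝ) (x : E n) : E n × ℝ :=
  (-(√(1 + ‖gradient g x‖ ^ 2))⁻¹ • gradient g x, (√(1 + ‖gradient g x‖ ^ 2))⁻¹)

theorem norm_graphNormal (g : E n → ℝ) (x : E n) :
    ‖WithLp.toLp 2 (graphNormal g x)‖ = 1 := by
  rw [← sq_eq_sq₀ (norm_nonneg _) zero_le_one, WithLp.prod_norm_sq_eq_of_L2]
  have h : √(1 + ‖gradient g x‖ ^ 2) ^ 2 = 1 + ‖gradient g x‖ ^ 2 := Real.sq_sqrt (by positivity)
  have h0 : 0 < √(1 + ‖gradient g x‖ ^ 2) := Real.sqrt_pos.mpr (by positivity)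
  simp only [graphNormal, WithLp.toLp_fst, WithLp.toLp_snd, norm_smul, norm_neg, norm_inv,
    Real.norm_eq_abs, abs_of_pos h0]
  field_simp
  linarith

/-- The divergence theorem for the unit normal field of a `C²` graph. -/
theorem exists_setIntegral_subgraph_fderiv_graphNormal {g : E n → ℝ} (hg : ContDiff ℝ 2 g) :
    ∃ D : E n → ℝ, Continuous D ∧ Continuous (graphNormal g) ∧
      ∀ f : E n × ℝ → ℝ, ContDiff ℝ 1 f → HasCompactSupport f →
      ∫ x, √(1 + ‖gradient g x‖ ^ 2) * f (x, g x) =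
        ∫ p in subgraph g, (fderiv ℝ f p (graphNormal g p.1) + D p.1 * f p) := by
  have hg1 : ContDiff ℝ 1 g := hg.of_le (by norm_num)
  have hgrad : ContDiff ℝ 1 (gradient g) :=
    (InnerProductSpace.toDual ℝ (E n)).symm.contDiff.comp
      (hg.fderiv_right (m := 1) (by norm_num))
  set c : E n → ℝ := fun x => √(1 + ‖gradient g x‖ ^ 2) with hc
  have hc0 : ∀ x, 0 < c x := fun x => Real.sqrt_pos.mpr (by positivity)
  have hcC : ContDiff ℝ 1 c :=
    ContDiff.sqrt (contDiff_const.add (hgrad.norm_sq ℝ)) fun x => by positivity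
  have hciC : ContDiff ℝ 1 fun x => (c x)⁻¹ := hcC.inv fun x => (hc0 x).ne'
  set N : Fin n → E n → ℝ := fun j x => -((c x)⁻¹ * gradient g x j) with hN
  have hNC : ∀ j, ContDiff ℝ 1 (N j) := fun j =>
    (hciC.mul ((EuclideanSpace.proj j : E n →L[ℝ] ℝ).contDiff.comp hgrad)).neg
  set e : Fin n → E n := fun j => EuclideanSpace.single j 1 with he
  have hgj : ∀ x j, fderiv ℝ g x (e j) = gradient g x j := by
    intro x j
    have : fderiv ℝ g x (e j) = inner ℝ (gradient g x) (e j) := by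
      rw [gradient, InnerProductSpace.toDual_symm_apply]
    rw [this, he, EuclideanSpace.inner_single_right]
    simp
  have hDc : ∀ j, Continuous fun x => fderiv ℝ (N j) x (e j) := fun j =>
    ((hNC j).continuous_fderiv one_ne_zero).clm_apply continuous_const
  -- `D` is the divergence of the normal field: its vertical component does not depend on the height
  -- and contributes nothing.
  refine ⟨fun x => ∑ j, fderiv ℝ (N j) x (e j), by fun_prop, ?_, fun f hf hfc => ?_⟩
  · have h1 := hciC.continuous
    have h2 := hgrad.continuous
    exact (h1.neg.smul h2).prodMk h1
  have hF : ∀ j, ContDiff ℝ 1 fun p : E n × ℝ => N j p.1 * f p := fun j =>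
    ((hNC j).comp contDiff_fst).mul hf
  have hV : ContDiff ℝ 1 fun p : E n × ℝ => (c p.1)⁻¹ * f p := (hciC.comp contDiff_fst).mul hf
  have hFd : ∀ j p, fderiv ℝ (fun p : E n × ℝ => N j p.1 * f p) p (e j, 0) =
      N j p.1 * fderiv ℝ f p (e j, 0) + fderiv ℝ (N j) p.1 (e j) * f p := by
    intro j p
    have h1 : HasFDerivAt (fun p : E n × ℝ => N j p.1) _ p :=
      ((hNC j).differentiable one_ne_zero p.1).hasFDerivAt.comp p hasFDerivAt_fst
    have h2 : HasFDerivAt (fun p : E n × ℝ => N j p.1 * f p) _ p :=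
      h1.mul (hf.differentiable one_ne_zero p).hasFDerivAt
    rw [h2.fderiv]
    simp [mul_comm]
  have hVd : ∀ p, fderiv ℝ (fun p : E n × ℝ => (c p.1)⁻¹ * f p) p (0, 1) =
      (c p.1)⁻¹ * fderiv ℝ f p (0, 1) := by
    intro p
    have h1 : HasFDerivAt (fun p : E n × ℝ => (c p.1)⁻¹) _ p :=
      (hciC.differentiable one_ne_zero p.1).hasFDerivAt.comp p hasFDerivAt_fst
    have h2 : HasFDerivAt (fun p : E n × ℝ => (c p.1)⁻¹ * f p) _ p :=
      h1.mul (hf.differentiable one_ne_zero p).hasFDerivAt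
    rw [h2.fderiv]
    simp
  have hnormal : ∀ p, fderiv ℝ f p (graphNormal g p.1) =
      ∑ j, N j p.1 * fderiv ℝ f p (e j, 0) + (c p.1)⁻¹ * fderiv ℝ f p (0, 1) := by
    intro p
    have h1 : graphNormal g p.1 = ∑ j, N j p.1 • (e j, (0 : ℝ)) + (c p.1)⁻¹ • ((0 : E n), (1 : ℝ)) := by
      refine Prod.ext ?_ ?_
      · simp only [Prod.fst_add, Prod.fst_sum, Prod.smul_fst, smul_zero, add_zero]
        ext i
        simp [graphNormal, hN, he, hc, Finset.sum_apply, Pi.single_apply]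
      · simp [graphNormal, hc, Prod.snd_sum]
    rw [h1, map_add, map_sum]
    simp only [map_smul, smul_eq_mul]
  have hsum : ∀ p : E n × ℝ, fderiv ℝ f p (graphNormal g p.1) +
      (∑ j, fderiv ℝ (N j) p.1 (e j)) * f p =
      ∑ j, fderiv ℝ (fun p : E n × ℝ => N j p.1 * f p) p (e j, 0) +
        fderiv ℝ (fun p : E n × ℝ => (c p.1)⁻¹ * f p) p (0, 1) := by
    intro p
    simp only [hFd, hVd, hnormal, Finset.sum_add_distrib, Finset.sum_mul]
    ring
  have hint : ∀ {F : E n × ℝ → ℝ} (_ : ContDiff ℝ 1 F) (_ : HasCompactSupport F) (w : E n × ℝ),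
      Integrable (fun p => fderiv ℝ F p w) (volume.restrict (subgraph g)) := fun hF hFc w =>
    (((hF.continuous_fderiv one_ne_zero).clm_apply
      continuous_const).integrable_of_hasCompactSupport (hFc.fderiv_apply ℝ w)).integrableOn
  have hgphc : HasCompactSupport fun x => f (x, g x) := by
    refine hfc.comp_isClosedEmbedding (g := fun x => (x, g x)) ?_
    refine Topology.IsClosedEmbedding.of_continuous_injective_isClosedMap
      (by have := hg.continuous; fun_prop) (fun a b h => (Prod.ext_iff.mp h).1) ?_
    refine Topology.IsClosedEmbedding.isClosedMap
      (Function.LeftInverse.isClosedEmbedding (f := Prod.fst) (fun x => rfl) continuous_fst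
        (by have := hg.continuous; fun_prop))
  have hfg : Continuous fun x => f (x, g x) := by
    have := hf.continuous
    have := hg.continuous
    fun_prop
  rw [integral_congr_ae (Eventually.of_forall hsum), integral_add, integral_finsetSum]
  · simp only [setIntegral_subgraph_fderiv_horizontal hg1 (hF _) hfc.mul_left,
      setIntegral_subgraph_fderiv_vertical hg.continuous hV hfc.mul_left]
    rw [Finset.sum_neg_distrib, ← integral_finsetSum, ← integral_neg, ← integral_add]
    · refine integral_congr_ae (Eventually.of_forall fun x => ?_)
      simp only [hgj, hN]
      -- The horizontal boundary terms give `c⁻¹ ‖∇g‖²` and the vertical one gives `c⁻¹`; their sum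
      -- is the area density `c`.
      have h1 : ∑ j, gradient g x j * (-((c x)⁻¹ * gradient g x j) * f (x, g x)) =
          -((c x)⁻¹ * ‖gradient g x‖ ^ 2 * f (x, g x)) := by
        rw [EuclideanSpace.norm_sq_eq, Finset.mul_sum, Finset.sum_mul, ← Finset.sum_neg_distrib]
        refine Finset.sum_congr rfl fun j _ => ?_
        rw [Real.norm_eq_abs, sq_abs]
        ring
      rw [h1]
      have h2 : c x ^ 2 = 1 + ‖gradient g x‖ ^ 2 := Real.sq_sqrt (by positivity)
      have h3 := (hc0 x).ne'
      change c x * f (x, g x) = _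
      field_simp
      rw [h2]
      ring
    · refine (integrable_finsetSum _ fun j _ => ?_).neg
      exact (((hg1.continuous_fderiv one_ne_zero).clm_apply continuous_const).mul
        ((hNC j).continuous.mul hfg)).integrable_of_hasCompactSupport hgphc.mul_left.mul_left
    · exact (hciC.continuous.mul hfg).integrable_of_hasCompactSupport hgphc.mul_left
    · exact fun j _ => (((hg1.continuous_fderiv one_ne_zero).clm_apply continuous_const).mul
        ((hNC j).continuous.mul hfg)).integrable_of_hasCompactSupport hgphc.mul_left.mul_left
  · exact fun j _ => hint (hF j) hfc.mul_left _
  · exact integrable_finsetSum _ fun j _ => hint (hF j) hfc.mul_left _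
  · exact hint hV hfc.mul_left _

end Subgraph

/-! ### The trace inequality for `C¹` functions -/

section TraceInequality

variable {d : ℕ}

/-- Expansion in the standard basis and Cauchy–Schwarz. That no extra factor appears is needed for
`C₁ = 2`. -/
theorem norm_fderiv_apply_le (φ : E d → ℂ) (x v : E d) :
    ‖fderiv ℝ φ x v‖ ≤ ‖grad φ x‖ * ‖v‖ := by
  have hv : v = ∑ i, v i • EuclideanSpace.single i (1 : ℝ) := by
    ext j
    simp [Finset.sum_apply, Pi.single_apply]
  conv_lhs => rw [hv, map_sum]
  calc ‖∑ i, fderiv ℝ φ x (v i • EuclideanSpace.single i (1 : ℝ))‖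
      ≤ ∑ i, ‖grad φ x i‖ * ‖v i‖ := by
        refine (norm_sum_le _ _).trans (Finset.sum_le_sum fun i _ => ?_)
        rw [map_smul, norm_smul, mul_comm]
        rfl
    _ ≤ √(∑ i, ‖grad φ x i‖ ^ 2) * √(∑ i, ‖v i‖ ^ 2) :=
        Real.sum_mul_le_sqrt_mul_sqrt _ _ _
    _ = ‖grad φ x‖ * ‖v‖ := by rw [← EuclideanSpace.norm_eq, ← EuclideanSpace.norm_eq]

theorem continuous_grad {φ : E d → ℂ} (hφ : ContDiff ℝ 1 φ) : Continuous (grad φ) := by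
  have : Continuous fun x => fun i => fderiv ℝ φ x (EuclideanSpace.single i (1 : ℝ)) :=
    continuous_pi fun i => (hφ.continuous_fderiv one_ne_zero).clm_apply continuous_const
  exact (PiLp.continuous_toLp 2 _).comp this

theorem integrable_vol_of_continuous {Ω : Set (E d)} (hΩ : Bornology.IsBounded Ω) {f : E d → ℝ}
    (hf : Continuous f) : Integrable f (vol Ω) :=
  (hf.continuousOn.integrableOn_compact hΩ.isCompact_closure).mono_set subset_closure

/-- In a chart, boundary points lie on the graph. -/
theorem snd_eq_of_mem_frontier {Ω V : Set (E d)} (hΩ : IsOpen Ω) (hV : IsOpen V)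
    {L : E d ≃ₗᵢ[ℝ] WithLp 2 (E (d - 1) × ℝ)} {g : E (d - 1) → ℝ} (hg : Continuous g)
    (hVg : ∀ x ∈ V, (x ∈ Ω ↔ (L x).snd < g (L x).fst)) {x : E d} (hx : x ∈ frontier Ω)
    (hxV : x ∈ V) : (L x).snd = g (L x).fst := by
  have hxΩ : x ∉ Ω := by
    rw [hΩ.frontier_eq] at hx
    exact hx.2
  refine le_antisymm ?_ (not_lt.mp fun h => hxΩ ((hVg x hxV).mpr h))
  have hcl : x ∈ closure (V ∩ Ω) := hV.inter_closure ⟨hxV, frontier_subset_closure hx⟩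
  have hc1 : Continuous fun y : E d => (L y).snd := by fun_prop
  have hc2 : Continuous fun y : E d => g (L y).fst := by fun_prop
  have hclosed : IsClosed {y : E d | (L y).snd ≤ g (L y).fst} := isClosed_le hc1 hc2
  exact closure_minimal (fun y hy => ((hVg y hy.1).mp hy.2).le) hclosed hcl

/-- The boundary integral of `χ |φ|²` is controlled near `z`, with leading constant `κ`. -/
def LocalTraceBound (Ω : Set (E d)) (κ : ℝ) (z : E d) : Prop :=
  ∃ V : Set (E d), IsOpen V ∧ z ∈ V ∧ ∀ χ : E d → ℝ, ContDiff ℝ ∞ χ → HasCompactSupport χ →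
    tsupport χ ⊆ V → (∀ x, 0 ≤ χ x) → ∃ C : ℝ, 0 ≤ C ∧ ∀ φ : E d → ℂ, ContDiff ℝ 1 φ →
      ∫⁻ x, ENNReal.ofReal (χ x * ‖φ x‖ ^ 2) ∂(surf Ω) ≤
        ENNReal.ofReal (∫ x, (2 * κ * (χ x * (‖φ x‖ * ‖grad φ x‖)) + C * ‖φ x‖ ^ 2) ∂(vol Ω))

/-- The coordinates `x ↦ L x` as a map to the plain product. -/
theorem measurePreserving_chart (L : E d ≃ₗᵢ[ℝ] WithLp 2 (E (d - 1) × ℝ)) :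
    MeasurePreserving (fun p : E (d - 1) × ℝ => L.symm (WithLp.toLp 2 p)) :=
  L.symm.measurePreserving.comp (WithLp.volume_preserving_toLp _ _)

/-- By `hgw` the surface integral of `χ |φ|²` is at most its integral against `w` over the base, and
`hdiv` turns that into a volume integral. The derivative along `N` falling on `|φ|²` costs at most
`2 κ χ |φ| |∇φ|`. Keeping `w`, `N` and `D` abstract covers `C²` and Lipschitz charts alike. -/
theorem localTraceBound_of_chart {Ω V : Set (E d)} (hΩ : IsOpen Ω)
    (hΩb : Bornology.IsBounded Ω) (hV : IsOpen V)
    {L : E d ≃ₗᵢ[ℝ] WithLp 2 (E (d - 1) × ℝ)} {g : E (d - 1) → ℝ} (hg : Continuous g)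
    (hVg : ∀ x ∈ V, (x ∈ Ω ↔ (L x).snd < g (L x).fst)) {w : E (d - 1) → ℝ} (hw : Continuous w)
    (hw0 : ∀ x, 0 ≤ w x)
    (hgw : ∀ A, MeasurableSet A → Measure.euclideanHausdorffMeasure (d - 1) (graphMap g '' A) ≤
      ∫⁻ x in A, ENNReal.ofReal (w x))
    {N : E (d - 1) → E (d - 1) × ℝ} (hN : Continuous N) {κ : ℝ}
    (hNκ : ∀ x, ‖WithLp.toLp 2 (N x)‖ ≤ κ) {D : E (d - 1) → ℝ} (hD : Continuous D)
    (hdiv : ∀ f : E (d - 1) × ℝ → ℝ, ContDiff ℝ 1 f → HasCompactSupport f →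
      ∫ x, w x * f (x, g x) = ∫ p in subgraph g, (fderiv ℝ f p (N p.1) + D p.1 * f p))
    {z : E d} (hz : z ∈ V) : LocalTraceBound Ω κ z := by
  refine ⟨V, hV, hz, fun χ hχ hχc hχV hχ0 => ?_⟩
  have hχ1 : ContDiff ℝ 1 χ := hχ.of_le (by norm_num)
  let Λ : (E (d - 1) × ℝ) ≃L[ℝ] E d :=
    (WithLp.prodContinuousLinearEquiv 2 ℝ (E (d - 1)) ℝ).symm.trans L.symm.toContinuousLinearEquiv
  have hΛ : ∀ p, Λ p = L.symm (WithLp.toLp 2 p) := fun p => rfl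
  have hΛs1 : ∀ x, (Λ.symm x).1 = (L x).fst := fun x => rfl
  have hΛs2 : ∀ x, (Λ.symm x).2 = (L x).snd := fun x => rfl
  have hΛm : MeasurePreserving Λ := measurePreserving_chart L
  have hΛn : ∀ p, ‖Λ p‖ = ‖WithLp.toLp 2 p‖ := fun p => by rw [hΛ, LinearIsometryEquiv.norm_map]
  set v : E d → E d := fun x => Λ (N (Λ.symm x).1) with hv
  have hvc : Continuous v := by fun_prop
  have hvκ : ∀ x, ‖v x‖ ≤ κ := fun x => (hΛn _).trans_le (hNκ _)
  -- `b` bounds the coefficient of `|φ|²`. It is continuous with compact support, so its bound `C`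
  -- does not depend on `φ`.
  set b : E d → ℝ := fun x => |fderiv ℝ χ x (v x)| + |D (Λ.symm x).1| * χ x with hb
  have hbc : Continuous b := by
    have h1 : Continuous fun x => fderiv ℝ χ x (v x) :=
      (hχ1.continuous_fderiv one_ne_zero).clm_apply hvc
    have h2 := hχ1.continuous
    fun_prop
  have hbs : HasCompactSupport b := by
    refine hχc.mono' fun x hx => ?_
    by_contra hxs
    have h1 : χ x = 0 := image_eq_zero_of_notMem_tsupport hxs
    have h2 : fderiv ℝ χ x = 0 := image_eq_zero_of_notMem_tsupport
      fun h => hxs (tsupport_fderiv_subset ℝ h)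
    exact hx (by simp [hb, h1, h2])
  obtain ⟨C, hC⟩ := hbs.exists_bound_of_continuous hbc
  have hC0 : 0 ≤ C := (norm_nonneg _).trans (hC 0)
  refine ⟨C, hC0, fun φ hφ => ?_⟩
  set F : E d → ℝ := fun x => χ x * ‖φ x‖ ^ 2 with hF
  have hφ2 : ContDiff ℝ 1 fun x => ‖φ x‖ ^ 2 := hφ.norm_sq ℝ
  have hFC : ContDiff ℝ 1 F := hχ1.mul hφ2
  have hFs : HasCompactSupport F := hχc.mul_right
  have hF0 : ∀ x, 0 ≤ F x := fun x => mul_nonneg (hχ0 x) (by positivity)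
  have hFV : ∀ x, x ∉ V → F x = 0 := fun x hx => by
    simp [hF, image_eq_zero_of_notMem_tsupport fun h => hx (hχV h)]
  have hFd : ∀ x u, fderiv ℝ F x u =
      fderiv ℝ χ x u * ‖φ x‖ ^ 2 + χ x * (2 * inner ℝ (φ x) (fderiv ℝ φ x u)) := by
    intro x u
    have h1 : HasFDerivAt F _ x := (hχ1.differentiable one_ne_zero x).hasFDerivAt.mul
      (hφ.differentiable one_ne_zero x).hasFDerivAt.norm_sq
    rw [h1.fderiv]
    simp
    ring
  set f : E (d - 1) × ℝ → ℝ := F ∘ Λ with hf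
  have hfC : ContDiff ℝ 1 f := hFC.comp Λ.contDiff
  have hfs : HasCompactSupport f := hFs.comp_homeomorph Λ.toHomeomorph
  set k : E d → ℝ := fun x => fderiv ℝ F x (v x) + D (Λ.symm x).1 * F x with hk
  have hkV : ∀ x, x ∉ V → k x = 0 := by
    intro x hx
    have h1 : x ∉ tsupport F := fun h => hx (hχV (closure_mono (fun y hy => by
      intro h0; exact hy (by simp [hF, h0])) h))
    have h2 : fderiv ℝ F x = 0 := image_eq_zero_of_notMem_tsupport
      fun h => h1 (tsupport_fderiv_subset ℝ h)
    simp [hk, h2, hFV x hx]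
  have hkc : Continuous k := by
    have h1 : Continuous fun x => fderiv ℝ F x (v x) :=
      (hFC.continuous_fderiv one_ne_zero).clm_apply hvc
    have h2 := hFC.continuous
    fun_prop
  have hkint : ∫ p in subgraph g, (fderiv ℝ f p (N p.1) + D p.1 * f p) = ∫ x, k x ∂(vol Ω) := by
    have h1 : ∀ p, fderiv ℝ f p (N p.1) + D p.1 * f p = k (Λ p) := by
      intro p
      have h2 : HasFDerivAt f _ p :=
        (hFC.differentiable one_ne_zero (Λ p)).hasFDerivAt.comp p Λ.hasFDerivAt
      rw [h2.fderiv]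
      simp [hk, hv, hf]
    have h3 : subgraph g = Λ ⁻¹' {x | (L x).snd < g (L x).fst} := by
      ext p
      simp [subgraph, hΛ]
    have hcont1 : Continuous fun y : E d => (L y).snd := by fun_prop
    have hcont2 : Continuous fun y : E d => g (L y).fst := by fun_prop
    have hopen : IsOpen {x : E d | (L x).snd < g (L x).fst} := isOpen_lt hcont1 hcont2
    rw [integral_congr_ae (Eventually.of_forall h1), h3,
      hΛm.setIntegral_preimage_emb Λ.toHomeomorph.measurableEmbedding, vol,
      ← integral_indicator hopen.measurableSet, ← integral_indicator hΩ.measurableSet]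
    congr 1
    ext x
    -- On `V` the chart identifies `Ω` with the subgraph; off `V` the integrand vanishes, so the two
    -- domains of integration are interchangeable.
    by_cases hx : x ∈ V
    · by_cases hxΩ : x ∈ Ω
      · rw [Set.indicator_of_mem hxΩ, Set.indicator_of_mem]
        exact (hVg x hx).mp hxΩ
      · rw [Set.indicator_of_notMem hxΩ, Set.indicator_of_notMem]
        exact fun h => hxΩ ((hVg x hx).mpr h)
    · simp [Set.indicator, hkV x hx]
  have hgc : Continuous fun x => w x * f (x, g x) := by
    have := hfC.continuous
    fun_prop
  have hgs : HasCompactSupport fun x => w x * f (x, g x) := by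
    refine HasCompactSupport.mul_left (f' := fun x => f (x, g x)) ?_
    exact hfs.comp_isClosedEmbedding (g := fun x => (x, g x))
      (Function.LeftInverse.isClosedEmbedding (f := Prod.fst) (fun x => rfl) continuous_fst
        (by fun_prop))
  have hsurf : ∫⁻ x, ENNReal.ofReal (F x) ∂(surf Ω) ≤
      ENNReal.ofReal (∫ x, w x * f (x, g x)) := by
    have h1 : ∫⁻ x, ENNReal.ofReal (F x) ∂(surf Ω) =
        ∫⁻ x in frontier Ω ∩ V, ENNReal.ofReal (F x)
          ∂(Measure.euclideanHausdorffMeasure (d - 1)) := by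
      rw [surf, ← lintegral_indicator isClosed_frontier.measurableSet,
        ← lintegral_indicator (isClosed_frontier.measurableSet.inter hV.measurableSet)]
      congr 1
      ext x
      by_cases hx : x ∈ V <;> by_cases hxf : x ∈ frontier Ω <;> simp [Set.indicator, hx, hxf, hFV]
    rw [h1, ofReal_integral_eq_lintegral_ofReal (hgc.integrable_of_hasCompactSupport hgs)
      (Eventually.of_forall fun x => mul_nonneg (hw0 x) (hF0 _))]
    refine (setLIntegral_euclideanHausdorffMeasure_graph_le (L := L.symm) L.symm.isometry hg
      (w := fun x => ENNReal.ofReal (w x)) (by fun_prop) hgw ?_ ?_).trans_eq ?_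
    · rintro x ⟨hx, hxV⟩
      refine ⟨(L x).fst, ?_⟩
      have h2 := snd_eq_of_mem_frontier hΩ hV hg hVg hx hxV
      simp only [graphMap]
      rw [← h2]
      exact L.symm_apply_apply x
    · have := hFC.continuous
      fun_prop
    · refine lintegral_congr fun x => ?_
      rw [← ENNReal.ofReal_mul (hw0 x)]
      rfl
  refine hsurf.trans (ENNReal.ofReal_le_ofReal ?_)
  rw [hdiv f hfC hfs, hkint]
  have hφc := hφ.continuous
  have hgrc := continuous_grad hφ
  have hχc' := hχ.continuous
  refine integral_mono (integrable_vol_of_continuous hΩb hkc)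
    (integrable_vol_of_continuous hΩb (by fun_prop)) fun x => ?_
  have h1 : |inner ℝ (φ x) (fderiv ℝ φ x (v x))| ≤ κ * (‖φ x‖ * ‖grad φ x‖) := by
    refine (abs_real_inner_le_norm _ _).trans ?_
    have h2 := (norm_fderiv_apply_le φ x (v x)).trans
      (mul_le_mul_of_nonneg_left (hvκ x) (norm_nonneg _))
    calc ‖φ x‖ * ‖fderiv ℝ φ x (v x)‖ ≤ ‖φ x‖ * (‖grad φ x‖ * κ) := by gcongr
      _ = _ := by ring
  have h2 : b x ≤ C := (Real.le_norm_self _).trans (hC x)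
  have h3 : fderiv ℝ χ x (v x) + D (Λ.symm x).1 * χ x ≤ b x :=
    add_le_add (le_abs_self _) (mul_le_mul_of_nonneg_right (le_abs_self _) (hχ0 x))
  have h4 : (0 : ℝ) ≤ ‖φ x‖ ^ 2 := by positivity
  have h5 := mul_le_mul_of_nonneg_left ((le_abs_self _).trans h1) (hχ0 x)
  have h6 := mul_le_mul_of_nonneg_right (h3.trans h2) h4
  simp only [hk, hFd]
  simp only [hF]
  nlinarith

/-- The unit normal field has length one and flux density equal to the area density, hence `κ = 1`.
-/
theorem localTraceBound_of_contDiff {Ω U : Set (E d)} (hΩ : IsOpen Ω)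
    (hΩb : Bornology.IsBounded Ω) {z : E d} (hU : U ∈ 𝓝 z)
    {L : E d ≃ₗᵢ[ℝ] WithLp 2 (E (d - 1) × ℝ)} {g : E (d - 1) → ℝ} (hg : ContDiff ℝ 2 g)
    (hUg : ∀ x ∈ U, (x ∈ Ω ↔ (L x).snd < g (L x).fst)) : LocalTraceBound Ω 1 z := by
  obtain ⟨D, hD, hN, hdiv⟩ := exists_setIntegral_subgraph_fderiv_graphNormal hg
  have hg1 : ContDiff ℝ 1 g := hg.of_le (by norm_num)
  have hgr := continuous_gradient hg1
  exact localTraceBound_of_chart hΩ hΩb isOpen_interior hg.continuous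
    (fun x hx => hUg x (interior_subset hx)) (w := fun x => √(1 + ‖gradient g x‖ ^ 2))
    (by fun_prop) (fun x => Real.sqrt_nonneg _)
    (fun A hA => euclideanHausdorffMeasure_graphMap_image_le hg1 hA) hN
    (fun x => (norm_graphNormal g x).le) hD hdiv (mem_interior_iff_mem_nhds.mpr hU)

/-- A constant vertical field of length `(1 + K)^(d - 1)`, the bound for the distortion of area,
needs no derivative of `g` and has no divergence. -/
theorem localTraceBound_of_lipschitz {Ω U : Set (E d)} (hΩ : IsOpen Ω)
    (hΩb : Bornology.IsBounded Ω) {z : E d} (hU : U ∈ 𝓝 z)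
    {L : E d ≃ₗᵢ[ℝ] WithLp 2 (E (d - 1) × ℝ)} {g : E (d - 1) → ℝ} {K : ℝ≥0}
    (hg : LipschitzWith K g) (hUg : ∀ x ∈ U, (x ∈ Ω ↔ (L x).snd < g (L x).fst)) :
    LocalTraceBound Ω ((1 + K) ^ (d - 1)) z := by
  have h0 : (0 : ℝ) ≤ (1 + K) ^ (d - 1) := by positivity
  refine localTraceBound_of_chart hΩ hΩb isOpen_interior hg.continuous
    (fun x hx => hUg x (interior_subset hx)) (w := fun _ => (1 + K) ^ (d - 1))
    continuous_const (fun x => h0) (fun A hA => ?_)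
    (N := fun _ => (0, (1 + K) ^ (d - 1))) continuous_const (fun x => ?_)
    (D := fun _ => 0) continuous_const (fun f hf hfs => ?_) (mem_interior_iff_mem_nhds.mpr hU)
  · refine (euclideanHausdorffMeasure_graphMap_image_le_of_lipschitz hg A).trans_eq ?_
    rw [setLIntegral_const, ENNReal.ofReal_pow (by positivity), ENNReal.ofReal_add zero_le_one
      (NNReal.coe_nonneg K)]
    simp
  · refine (norm_withLp_le_add _).trans_eq ?_
    simp [abs_of_nonneg (add_nonneg zero_le_one K.coe_nonneg)]
  · rw [integral_const_mul, ← setIntegral_subgraph_fderiv_vertical hg.continuous hf hfs,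
      ← integral_const_mul]
    refine integral_congr_ae (Eventually.of_forall fun p => ?_)
    simp only [zero_mul, add_zero]
    rw [← smul_eq_mul, ← map_smul]
    simp

end TraceInequality

/-! ### Gluing local trace bounds with a partition of unity -/

section GlobalTraceInequality

variable {d : ℕ}

/-- Smooth partitions of unity with compact supports on a compact set. -/
theorem exists_finset_smooth_partition {K : Set (E d)} (hK : IsCompact K) {V : E d → Set (E d)}
    (hV : ∀ z ∈ K, IsOpen (V z) ∧ z ∈ V z) :
    ∃ t : Finset (E d), (∀ z ∈ t, z ∈ K) ∧ ∃ χ : E d → E d → ℝ,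
      (∀ z ∈ t, ContDiff ℝ ∞ (χ z) ∧ HasCompactSupport (χ z) ∧ tsupport (χ z) ⊆ V z ∧
        ∀ x, 0 ≤ χ z x) ∧
      (∀ x ∈ K, ∑ z ∈ t, χ z x = 1) ∧ ∀ x, ∑ z ∈ t, χ z x ≤ 1 := by
  -- The unit balls serve only to make the supports compact.
  obtain ⟨t, htK, ht⟩ := hK.elim_nhds_subcover (fun z => V z ∩ Metric.ball z 1) fun z hz =>
    inter_mem ((hV z hz).1.mem_nhds (hV z hz).2) (Metric.ball_mem_nhds z one_pos)
  obtain ⟨f, hf⟩ := SmoothPartitionOfUnity.exists_isSubordinate (modelWithCornersSelf ℝ (E d))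
    hK.isClosed (fun z : t => V z ∩ Metric.ball (z : E d) 1)
    (fun z => (hV z (htK z z.2)).1.inter Metric.isOpen_ball) (by
      intro x hx
      obtain ⟨z, hz, hxz⟩ := Set.mem_iUnion₂.mp (ht hx)
      exact Set.mem_iUnion.mpr ⟨⟨z, hz⟩, hxz⟩)
  have hsum : ∀ x, ∑ z ∈ t, (if h : z ∈ t then f ⟨z, h⟩ x else 0) = ∑ᶠ i, f i x := by
    intro x
    rw [finsum_eq_sum_of_fintype, ← Finset.sum_attach, Finset.univ_eq_attach]
    exact Finset.sum_congr rfl fun z _ => by simp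
  refine ⟨t, htK, fun z x => if h : z ∈ t then f ⟨z, h⟩ x else 0, fun z hz => ?_, fun x hx => ?_,
    fun x => ?_⟩
  · simp only [hz, dif_pos]
    have hs := hf ⟨z, hz⟩
    refine ⟨(f ⟨z, hz⟩).contMDiff.contDiff, ?_, hs.trans Set.inter_subset_left,
      fun x => f.nonneg _ x⟩
    exact HasCompactSupport.of_support_subset_isCompact (isCompact_closedBall z 1)
      ((subset_tsupport _).trans (hs.trans (Set.inter_subset_right.trans Metric.ball_subset_closedBall)))
  · rw [hsum, f.sum_eq_one hx]
  · rw [hsum]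
    exact f.sum_le_one x

/-- Local constants for `|φ|²` add up, but the leading terms are weighted by `χ z` with `∑ χ z ≤ 1`,
so their maximum suffices. The finite set `t` is produced before `K`, since `K` has only to dominate
`κ` on `t`. -/
theorem exists_lintegral_surf_le {Ω : Set (E d)} (hΩb : Bornology.IsBounded Ω) {κ : E d → ℝ}
    (hκ : ∀ z ∈ frontier Ω, LocalTraceBound Ω (κ z) z) :
    ∃ t : Finset (E d), (∀ z ∈ t, z ∈ frontier Ω) ∧ ∀ K : ℝ, 0 ≤ K → (∀ z ∈ t, κ z ≤ K) →
      ∃ C : ℝ, 0 ≤ C ∧ ∀ φ : E d → ℂ, ContDiff ℝ 1 φ →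
        ∫⁻ x, ENNReal.ofReal (‖φ x‖ ^ 2) ∂(surf Ω) ≤
          ENNReal.ofReal (∫ x, (2 * K * (‖φ x‖ * ‖grad φ x‖) + C * ‖φ x‖ ^ 2) ∂(vol Ω)) := by
  have hcpt : IsCompact (frontier Ω) :=
    hΩb.isCompact_closure.of_isClosed_subset isClosed_frontier frontier_subset_closure
  choose! V hVo hzV hV using hκ
  obtain ⟨t, ht, χ, hχ, hχ1, hχle⟩ := exists_finset_smooth_partition hcpt
    (V := V) fun z hz => ⟨hVo z hz, hzV z hz⟩
  refine ⟨t, ht, fun K hK0 hK => ?_⟩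
  have hC : ∀ z, ∃ C : ℝ, 0 ≤ C ∧ (z ∈ t → ∀ φ : E d → ℂ, ContDiff ℝ 1 φ →
      ∫⁻ x, ENNReal.ofReal (χ z x * ‖φ x‖ ^ 2) ∂(surf Ω) ≤ ENNReal.ofReal
        (∫ x, (2 * κ z * (χ z x * (‖φ x‖ * ‖grad φ x‖)) + C * ‖φ x‖ ^ 2) ∂(vol Ω))) := by
    intro z
    by_cases hz : z ∈ t
    · obtain ⟨h1, h2, h3, h4⟩ := hχ z hz
      obtain ⟨C, hC0, hC⟩ := hV z (ht z hz) (χ z) h1 h2 h3 h4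
      exact ⟨C, hC0, fun _ => hC⟩
    · exact ⟨0, le_rfl, fun h => absurd h hz⟩
  choose C hC0 hC using hC
  refine ⟨∑ z ∈ t, C z, Finset.sum_nonneg fun z _ => hC0 z, fun φ hφ => ?_⟩
  have hφc := hφ.continuous
  have hgrc := continuous_grad hφ
  have hint : ∀ z ∈ t, Integrable
      (fun x => 2 * K * (χ z x * (‖φ x‖ * ‖grad φ x‖)) + C z * ‖φ x‖ ^ 2) (vol Ω) := by
    intro z hz
    have := (hχ z hz).1.continuous
    exact integrable_vol_of_continuous hΩb (by fun_prop)
  have hint' : ∀ z ∈ t, Integrable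
      (fun x => 2 * κ z * (χ z x * (‖φ x‖ * ‖grad φ x‖)) + C z * ‖φ x‖ ^ 2) (vol Ω) := by
    intro z hz
    have := (hχ z hz).1.continuous
    exact integrable_vol_of_continuous hΩb (by fun_prop)
  calc ∫⁻ x, ENNReal.ofReal (‖φ x‖ ^ 2) ∂(surf Ω)
      = ∫⁻ x, ∑ z ∈ t, ENNReal.ofReal (χ z x * ‖φ x‖ ^ 2) ∂(surf Ω) := by
        refine setLIntegral_congr_fun isClosed_frontier.measurableSet fun x hx => ?_
        rw [← ENNReal.ofReal_sum_of_nonneg, ← Finset.sum_mul, hχ1 x hx, one_mul]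
        exact fun z hz => mul_nonneg ((hχ z hz).2.2.2 x) (by positivity)
    _ = ∑ z ∈ t, ∫⁻ x, ENNReal.ofReal (χ z x * ‖φ x‖ ^ 2) ∂(surf Ω) := by
        refine lintegral_finsetSum' _ fun z hz => ?_
        have := (hχ z hz).1.continuous
        have h : Continuous fun x => χ z x * ‖φ x‖ ^ 2 := by fun_prop
        exact h.measurable.ennreal_ofReal.aemeasurable
    _ ≤ ∑ z ∈ t, ENNReal.ofReal
          (∫ x, (2 * K * (χ z x * (‖φ x‖ * ‖grad φ x‖)) + C z * ‖φ x‖ ^ 2) ∂(vol Ω)) := by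
        refine Finset.sum_le_sum fun z hz => (hC z hz φ hφ).trans (ENNReal.ofReal_le_ofReal ?_)
        refine integral_mono (hint' z hz) (hint z hz) fun x => ?_
        have := (hχ z hz).2.2.2 x
        have := hK z hz
        simp only
        gcongr
    _ = ENNReal.ofReal (∫ x, ∑ z ∈ t,
          (2 * K * (χ z x * (‖φ x‖ * ‖grad φ x‖)) + C z * ‖φ x‖ ^ 2) ∂(vol Ω)) := by
        rw [integral_finsetSum _ hint, ENNReal.ofReal_sum_of_nonneg]
        refine fun z hz => integral_nonneg fun x => ?_
        have := (hχ z hz).2.2.2 x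
        have := hC0 z
        positivity
    _ ≤ _ := by
        refine ENNReal.ofReal_le_ofReal (integral_mono (integrable_finsetSum _ hint)
          (integrable_vol_of_continuous hΩb (by fun_prop)) fun x => ?_)
        have h1 : (∑ z ∈ t, χ z x) * (‖φ x‖ * ‖grad φ x‖) ≤ ‖φ x‖ * ‖grad φ x‖ :=
          mul_le_of_le_one_left (by positivity) (hχle x)
        have h2 := mul_le_mul_of_nonneg_left h1 (mul_nonneg zero_le_two hK0)
        simp only
        rw [Finset.sum_add_distrib, ← Finset.mul_sum, ← Finset.sum_mul, ← Finset.sum_mul]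
        linarith

theorem eLpNorm_two_sq {X F : Type*} [MeasurableSpace X] [NormedAddCommGroup F] (f : X → F)
    (μ : Measure X) : eLpNorm f 2 μ ^ 2 = ∫⁻ x, ‖f x‖ₑ ^ 2 ∂μ := by
  have := eLpNorm_nnreal_pow_eq_lintegral (f := f) (μ := μ) (p := 2) two_ne_zero
  simpa using this

/-- The trace inequality with leading constant `C₁`: for all `φ ∈ C¹(ℝᵈ)`,
`‖φ‖²_{L²(∂Ω)} ≤ C₁ ‖φ‖ ‖∇φ‖ + C₂ ‖φ‖²` with norms in `L²(Ω)`. -/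
def TraceInequality (Ω : Set (E d)) (C₁ C₂ : ℝ) : Prop :=
  ∀ φ : E d → ℂ, ContDiff ℝ 1 φ → eLpNorm φ 2 (surf Ω) ^ 2 ≤
    ENNReal.ofReal C₁ * (eLpNorm φ 2 (vol Ω) * eLpNorm (grad φ) 2 (vol Ω)) +
      ENNReal.ofReal C₂ * eLpNorm φ 2 (vol Ω) ^ 2

theorem traceInequality_of_lintegral_le {Ω : Set (E d)} (hΩb : Bornology.IsBounded Ω) {K C : ℝ}
    (hK : 0 ≤ K) (hC : 0 ≤ C) (h : ∀ φ : E d → ℂ, ContDiff ℝ 1 φ →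
      ∫⁻ x, ENNReal.ofReal (‖φ x‖ ^ 2) ∂(surf Ω) ≤
        ENNReal.ofReal (∫ x, (2 * K * (‖φ x‖ * ‖grad φ x‖) + C * ‖φ x‖ ^ 2) ∂(vol Ω))) :
    TraceInequality Ω (2 * K) C := by
  intro φ hφ
  have hφc := hφ.continuous
  have hgrc := continuous_grad hφ
  have hsq : ∀ x, ENNReal.ofReal (‖φ x‖ ^ 2) = ‖φ x‖ₑ ^ 2 := fun x => by
    rw [ENNReal.ofReal_pow (norm_nonneg _), ofReal_norm]
  have h1 := h φ hφ
  simp only [hsq, ← eLpNorm_two_sq] at h1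
  refine h1.trans ?_
  rw [ofReal_integral_eq_lintegral_ofReal (integrable_vol_of_continuous hΩb (by fun_prop))
    (Eventually.of_forall fun x => by positivity)]
  have h2 : ∀ x, ENNReal.ofReal (2 * K * (‖φ x‖ * ‖grad φ x‖) + C * ‖φ x‖ ^ 2) =
      ENNReal.ofReal (2 * K) * (‖φ x‖ₑ * ‖grad φ x‖ₑ) + ENNReal.ofReal C * ‖φ x‖ₑ ^ 2 := by
    intro x
    rw [ENNReal.ofReal_add (by positivity) (by positivity), ENNReal.ofReal_mul (by positivity),
      ENNReal.ofReal_mul hC, hsq, ENNReal.ofReal_mul (norm_nonneg _), ofReal_norm, ofReal_norm]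
  simp only [h2]
  rw [lintegral_add_right _ (by fun_prop), lintegral_const_mul _ (by fun_prop),
    lintegral_const_mul _ (by fun_prop), ← eLpNorm_two_sq]
  gcongr
  have h3 := ENNReal.lintegral_mul_le_Lp_mul_Lq (vol Ω) Real.HolderConjugate.two_two
    (f := fun x => ‖φ x‖ₑ) (g := fun x => ‖grad φ x‖ₑ) (by fun_prop) (by fun_prop)
  have h4 : ∀ {F : Type} [NormedAddCommGroup F] (f : E d → F),
      eLpNorm f 2 (vol Ω) = (∫⁻ x, ‖f x‖ₑ ^ (2 : ℝ) ∂(vol Ω)) ^ (1 / (2 : ℝ)) := by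
    intro F _ f
    rw [eLpNorm_eq_lintegral_rpow_enorm_toReal two_ne_zero ENNReal.ofNat_ne_top]
    simp
  rw [h4, h4]
  exact h3

/-- When the boundary is `C²` all local constants are `1`, giving `C₁ = 2`; otherwise any bound for
the finitely many local constants will do. Adding `1` to `C₂` makes it positive. -/
theorem exists_traceInequality {Ω : Set (E d)} (hΩ : IsBoundedLipschitzDomain Ω) :
    ∃ C₁ C₂ : ℝ, 2 ≤ C₁ ∧ 0 < C₂ ∧ (HasC2Boundary Ω → C₁ = 2) ∧ TraceInequality Ω C₁ C₂ := by
  have weaken : ∀ {C₁ C₂ : ℝ}, 0 ≤ C₂ → TraceInequality Ω C₁ C₂ →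
      TraceInequality Ω C₁ (C₂ + 1) := fun hC h φ hφ => (h φ hφ).trans (by gcongr; linarith)
  by_cases h2 : HasC2Boundary Ω
  · obtain ⟨t, -, ht⟩ := exists_lintegral_surf_le hΩ.isBounded (κ := fun _ => 1) fun z hz => by
      obtain ⟨L, U, hU, g, hg, hUg⟩ := h2 z hz
      exact localTraceBound_of_contDiff hΩ.isOpen hΩ.isBounded hU hg hUg
    obtain ⟨C, hC, h⟩ := ht 1 zero_le_one fun _ _ => le_rfl
    have h3 := traceInequality_of_lintegral_le hΩ.isBounded zero_le_one hC h
    rw [mul_one] at h3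
    exact ⟨2, C + 1, le_rfl, by positivity, fun _ => rfl, weaken hC h3⟩
  · have hloc : ∀ z, ∃ κ : ℝ, z ∈ frontier Ω → LocalTraceBound Ω κ z := fun z => by
      by_cases hz : z ∈ frontier Ω
      · obtain ⟨L, U, hU, g, ⟨K, hg⟩, hUg⟩ := hΩ.lipschitz z hz
        exact ⟨_, fun _ => localTraceBound_of_lipschitz hΩ.isOpen hΩ.isBounded hU hg hUg⟩
      · exact ⟨0, fun h => absurd h hz⟩
    choose κ hκ using hloc
    obtain ⟨t, -, ht⟩ := exists_lintegral_surf_le hΩ.isBounded hκ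
    have hK : ∀ z ∈ t, κ z ≤ 1 + ∑ y ∈ t, |κ y| := fun z hz => by
      have := Finset.single_le_sum (f := fun y => |κ y|) (fun y _ => abs_nonneg _) hz
      have := le_abs_self (κ z)
      linarith
    have hK1 : 1 ≤ 1 + ∑ y ∈ t, |κ y| := by
      have := Finset.sum_nonneg (f := fun y => |κ y|) (s := t) fun y _ => abs_nonneg _
      linarith
    obtain ⟨C, hC, h⟩ := ht _ (zero_le_one.trans hK1) hK
    exact ⟨_, C + 1, by linarith, by positivity, fun h => absurd h h2,
      weaken hC (traceInequality_of_lintegral_le hΩ.isBounded (zero_le_one.trans hK1) hC h)⟩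

end GlobalTraceInequality

/-! ### Mollification in `L²` -/

section Mollification

variable {d : ℕ} {F : Type*} [NormedAddCommGroup F]

/-- Translations act continuously on `L²`. -/
theorem exists_eLpNorm_translate_sub_le {f : E d → F} (hf : MemLp f 2 volume) {ε : ℝ≥0∞}
    (hε : 0 < ε) :
    ∃ δ > 0, ∀ w : E d, ‖w‖ < δ → eLpNorm (fun x => f (x - w) - f x) 2 volume ≤ ε := by
  set T : E d → C(E d, E d) := fun w => ⟨fun x => x - w, by fun_prop⟩ with hT
  have hTm : ∀ w, MeasurePreserving (T w) (volume : Measure (E d)) volume :=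
    fun w => measurePreserving_sub_right volume w
  have hTc : Continuous T :=
    ContinuousMap.continuous_of_continuous_uncurry _ (by
      change Continuous fun p : E d × E d => p.2 - p.1
      fun_prop)
  have hcont : Continuous fun w => Lp.compMeasurePreserving (T w) (hTm w) (hf.toLp f) :=
    Continuous.compMeasurePreservingLp continuous_const hTc hTm ENNReal.ofNat_ne_top
  have h0 := Metric.eventually_nhds_iff.mp
    (hcont.continuousAt (x := 0) |>.eventually (Metric.eball_mem_nhds _ hε))
  obtain ⟨δ, hδ, h⟩ := h0
  refine ⟨δ, hδ, fun w hw => ?_⟩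
  have h1 := h (y := w) (by simpa using hw)
  have h2 : ∀ w, Lp.compMeasurePreserving (T w) (hTm w) (hf.toLp f) =
      (hf.comp_measurePreserving (hTm w)).toLp _ := fun w => rfl
  simp only [h2, Lp.edist_toLp_toLp] at h1
  refine le_trans (le_of_eq ?_) h1.le
  refine eLpNorm_congr_ae (Eventually.of_forall fun x => ?_)
  simp [hT]

/-- Convolution with a probability density supported near the origin is close to the identity
in `L²`. -/
theorem eLpNorm_convolution_sub_le [NormedSpace ℝ F] [CompleteSpace F] {f : E d → F} (hf : MemLp f 2 volume)
    (hfm : StronglyMeasurable f) {k : E d → ℝ} (hk : Continuous k) (hkc : HasCompactSupport k)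
    (hk0 : ∀ x, 0 ≤ k x) (hk1 : ∫ x, k x = 1) {ε : ℝ≥0∞}
    (hkε : ∀ w, k w ≠ 0 → eLpNorm (fun x => f (x - w) - f x) 2 volume ≤ ε) :
    eLpNorm (fun x => convolution k f (ContinuousLinearMap.lsmul ℝ ℝ) volume x - f x) 2 volume ≤
      ε := by
  have hloc : LocallyIntegrable f volume := hf.locallyIntegrable (by norm_num)
  have hki : Integrable k volume := hk.integrable_of_hasCompactSupport hkc
  -- The convolution error is an average of translation errors over the probability measure `μ`. Its
  -- square is at most the average of the squares, and Tonelli reduces the claim to single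
  -- translations.
  set μ : Measure (E d) := volume.withDensity fun w => ENNReal.ofReal (k w) with hμ
  have hprob : IsProbabilityMeasure μ := by
    constructor
    rw [hμ, withDensity_apply _ MeasurableSet.univ, setLIntegral_univ,
      ← ofReal_integral_eq_lintegral_ofReal hki (Eventually.of_forall hk0), hk1, ENNReal.ofReal_one]
  have hμae : ∀ᵐ w ∂μ, k w ≠ 0 := by
    rw [hμ, ae_withDensity_iff (by fun_prop)]
    exact Eventually.of_forall fun w hw => by
      intro h0
      simp [h0] at hw
  have hpt : ∀ x, ‖convolution k f (ContinuousLinearMap.lsmul ℝ ℝ) volume x - f x‖ₑ ^ 2 ≤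
      ∫⁻ w, ‖f (x - w) - f x‖ₑ ^ 2 ∂μ := by
    intro x
    have hex : Integrable (fun w => k w • f (x - w)) volume :=
      hkc.convolutionExists_left (ContinuousLinearMap.lsmul ℝ ℝ) hk hloc x
    have h1 : convolution k f (ContinuousLinearMap.lsmul ℝ ℝ) volume x - f x =
        ∫ w, k w • (f (x - w) - f x) := by
      have h2 : f x = ∫ w, k w • f x := by rw [integral_smul_const, hk1, one_smul]
      conv_lhs => rw [h2]
      simp only [smul_sub]
      rw [integral_sub hex (hki.smul_const _)]
      rfl
    have h3 : ‖∫ w, k w • (f (x - w) - f x)‖ₑ ≤ ∫⁻ w, ‖f (x - w) - f x‖ₑ ∂μ := by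
      refine (enorm_integral_le_lintegral_enorm _).trans_eq ?_
      rw [hμ, lintegral_withDensity_eq_lintegral_mul _ (by fun_prop)]
      · refine lintegral_congr fun w => ?_
        rw [enorm_smul, Pi.mul_apply, Real.enorm_of_nonneg (hk0 w)]
      · exact ((hfm.comp_measurable (measurable_const.sub measurable_id)).sub
          stronglyMeasurable_const).enorm
    have hmeas : AEStronglyMeasurable (fun w => f (x - w) - f x) μ :=
      ((hfm.comp_measurable (measurable_const.sub measurable_id)).sub
        stronglyMeasurable_const).aestronglyMeasurable
    have h4 : ∫⁻ w, ‖f (x - w) - f x‖ₑ ∂μ ≤ eLpNorm (fun w => f (x - w) - f x) 2 μ := by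
      rw [← eLpNorm_one_eq_lintegral_enorm]
      exact eLpNorm_le_eLpNorm_of_exponent_le (by norm_num) hmeas
    rw [h1, ← eLpNorm_two_sq]
    gcongr
    exact h3.trans h4
  have hjoint : Measurable fun p : E d × E d => ‖f (p.1 - p.2) - f p.1‖ₑ ^ 2 :=
    (((hfm.comp_measurable (measurable_fst.sub measurable_snd)).sub
      (hfm.comp_measurable measurable_fst)).enorm).pow_const 2
  rw [← ENNReal.pow_le_pow_left_iff two_ne_zero, eLpNorm_two_sq]
  calc ∫⁻ x, ‖convolution k f (ContinuousLinearMap.lsmul ℝ ℝ) volume x - f x‖ₑ ^ 2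
      ≤ ∫⁻ x, ∫⁻ w, ‖f (x - w) - f x‖ₑ ^ 2 ∂μ := lintegral_mono hpt
    _ = ∫⁻ w, (∫⁻ x, ‖f (x - w) - f x‖ₑ ^ 2) ∂μ := lintegral_lintegral_swap hjoint.aemeasurable
    _ ≤ ∫⁻ w, ε ^ 2 ∂μ := by
        refine lintegral_mono_ae ?_
        filter_upwards [hμae] with w hw
        rw [← eLpNorm_two_sq]
        gcongr
        exact hkε w hw
    _ = ε ^ 2 := by simp

end Mollification

/-! ### Cone condition at the boundary of a Lipschitz domain -/

section OutwardDirection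

variable {d : ℕ}

/-- Near each point of the closure there is a direction `e` such that translating by `-τ e`, and
further by an error of size `c τ`, moves points of `Ω` into `Ω`. -/
theorem exists_inward_cone {Ω : Set (E d)} (hΩ : IsBoundedLipschitzDomain Ω) {z : E d}
    (hz : z ∈ closure Ω) :
    ∃ V : Set (E d), IsOpen V ∧ z ∈ V ∧ ∃ e : E d, ∃ c > 0, ∀ S ⊆ V, IsCompact S → ∃ τ₀ > 0,
      ∀ τ, 0 < τ → τ < τ₀ → ∀ x ∈ Ω, ∀ w ∈ S, ‖x - w - τ • e‖ ≤ c * τ → w ∈ Ω := by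
  by_cases hzΩ : z ∈ Ω
  · exact ⟨Ω, hΩ.isOpen, hzΩ, 0, 1, one_pos, fun S hS _ => ⟨1, one_pos,
      fun τ _ _ x _ w hw _ => hS hw⟩⟩
  have hzf : z ∈ frontier Ω := by
    rw [hΩ.isOpen.frontier_eq]
    exact ⟨hz, hzΩ⟩
  obtain ⟨L, U, hU, g, ⟨K, hg⟩, hUg⟩ := hΩ.lipschitz z hzf
  -- `e` is the upward direction of the chart. An error of size `c τ` costs `c τ` in height and `K c
  -- τ` in the value of `g`; `c = 1 / (1 + K)` makes the sum equal to the descent `τ`, and `x` lies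
  -- strictly below the graph.
  refine ⟨interior U, isOpen_interior, mem_interior_iff_mem_nhds.mpr hU,
    L.symm (WithLp.toLp 2 (0, 1)), (1 + (K : ℝ))⁻¹, by positivity, fun S hS hSc => ?_⟩
  -- This margin keeps `x` in the chart: it is at distance at most `(1 + c) τ` from `w ∈ S`.
  obtain ⟨δ, hδ, hthick⟩ := hSc.exists_thickening_subset_open isOpen_interior hS
  set e : E d := L.symm (WithLp.toLp 2 (0, 1)) with he
  set c : ℝ := (1 + (K : ℝ))⁻¹ with hc
  have hc0 : 0 < c := by positivity
  have hcK : c * (1 + K) = 1 := inv_mul_cancel₀ (by positivity)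
  have hen : ‖e‖ ≤ 1 := by
    rw [he, LinearIsometryEquiv.norm_map]
    refine (norm_withLp_le_add _).trans ?_
    simp
  refine ⟨δ / (1 + c), by positivity, fun τ hτ hτδ x hx w hw hxw => ?_⟩
  have hwU : w ∈ U := interior_subset (hS hw)
  have hxU : x ∈ U := by
    refine interior_subset (hthick (Metric.mem_thickening_iff.mpr ⟨w, hw, ?_⟩))
    rw [dist_eq_norm]
    rw [lt_div_iff₀ (by positivity)] at hτδ
    calc ‖x - w‖ = ‖(x - w - τ • e) + τ • e‖ := by rw [sub_add_cancel]
      _ ≤ c * τ + τ * 1 := by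
          refine (norm_add_le _ _).trans (add_le_add hxw ?_)
          rw [norm_smul, Real.norm_of_nonneg hτ.le]
          gcongr
      _ < δ := by linarith
  rw [hUg w hwU]
  have hxg := (hUg x hxU).mp hx
  set r := x - w - τ • e with hr
  have hLr : L r = L x - L w - τ • WithLp.toLp 2 ((0 : E (d - 1)), (1 : ℝ)) := by
    rw [hr, map_sub, map_sub, map_smul, he, LinearIsometryEquiv.apply_symm_apply]
  have hr1 : (L r).fst = (L x).fst - (L w).fst := by rw [hLr]; simp
  have hr2 : (L r).snd = (L x).snd - (L w).snd - τ := by rw [hLr]; simp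
  have hrn : ‖L r‖ ≤ c * τ := by rwa [LinearIsometryEquiv.norm_map]
  have h1 : ‖(L x).fst - (L w).fst‖ ≤ c * τ := by
    rw [← hr1]
    exact (norm_le_norm_withLp _).trans hrn
  have h2 : |(L x).snd - (L w).snd - τ| ≤ c * τ := by
    rw [← hr2]
    refine le_trans ?_ hrn
    rw [← Real.norm_eq_abs, ← sq_le_sq₀ (norm_nonneg _) (norm_nonneg _),
      WithLp.prod_norm_sq_eq_of_L2]
    nlinarith [sq_nonneg ‖(L r).fst‖]
  have h3 := hg.dist_le_mul (L x).fst (L w).fst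
  rw [dist_eq_norm, dist_eq_norm, Real.norm_eq_abs] at h3
  have h4 : (K : ℝ) * ‖(L x).fst - (L w).fst‖ ≤ K * (c * τ) :=
    mul_le_mul_of_nonneg_left h1 K.coe_nonneg
  have h5 := abs_le.mp h2
  have h6 := abs_le.mp (h3.trans h4)
  have h7 : c * τ + K * (c * τ) = τ := by
    calc c * τ + K * (c * τ) = (c * (1 + K)) * τ := by ring
      _ = τ := by rw [hcK, one_mul]
  linarith [h5.1, h6.2]

end OutwardDirection

/-! ### Density of smooth functions in `H¹(Ω)` -/

section Density

variable {d : ℕ}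

theorem isFiniteMeasure_vol {Ω : Set (E d)} (hΩ : Bornology.IsBounded Ω) :
    IsFiniteMeasure (vol Ω) :=
  ⟨by simpa [vol] using hΩ.measure_lt_top⟩

theorem MemLp.integrable_vol {Ω : Set (E d)} (hΩ : Bornology.IsBounded Ω) {F : Type*}
    [NormedAddCommGroup F] {u : E d → F} (hu : MemLp u 2 (vol Ω)) : Integrable u (vol Ω) := by
  have := isFiniteMeasure_vol hΩ
  exact hu.integrable (by norm_num)

theorem memLp_apply {μ : Measure (E d)} {G : E d → EuclideanSpace ℂ (Fin d)} (hG : MemLp G 2 μ)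
    (i : Fin d) : MemLp (fun x => G x i) 2 μ :=
  (EuclideanSpace.proj i : EuclideanSpace ℂ (Fin d) →L[ℂ] ℂ).comp_memLp' hG

theorem integrable_smul_of_compact {Ω : Set (E d)} {F : Type*} [NormedAddCommGroup F]
    [NormedSpace ℝ F] {u : E d → F} (hu : Integrable u (vol Ω)) {a : E d → ℝ} (ha : Continuous a)
    (hac : HasCompactSupport a) : Integrable (fun x => a x • u x) (vol Ω) :=
  hu.smul_of_top_right (ha.memLp_top_of_hasCompactSupport hac _)

theorem IsWeakGrad.congr {Ω : Set (E d)} {u u' : E d → ℂ} {G G' : E d → EuclideanSpace ℂ (Fin d)}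
    (h : IsWeakGrad Ω u G) (hu : u =ᵐ[vol Ω] u') (hG : G =ᵐ[vol Ω] G') : IsWeakGrad Ω u' G' := by
  refine ⟨h.1.ae_eq hG, fun η h1 h2 h3 i => ?_⟩
  have := h.2 η h1 h2 h3 i
  rw [← integral_congr_ae (μ := vol Ω) (f := fun x => fderiv ℝ η x (EuclideanSpace.single i 1) • u x),
    this, integral_congr_ae (μ := vol Ω) (f := fun x => η x • G x i)]
  · filter_upwards [hG] with x hx
    rw [hx]
  · filter_upwards [hu] with x hx
    rw [hx]

/-- The product rule for weak gradients, tested against functions `η` for which `η χ` is supported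
in `Ω`. -/
theorem IsWeakGrad.integral_mul {Ω : Set (E d)} (hΩb : Bornology.IsBounded Ω) {u : E d → ℂ}
    {G : E d → EuclideanSpace ℂ (Fin d)} (hu : MemLp u 2 (vol Ω)) (h : IsWeakGrad Ω u G)
    {χ η : E d → ℝ} (hχ : ContDiff ℝ ∞ χ) (hη : ContDiff ℝ ∞ η) (hηc : HasCompactSupport η)
    (hs : tsupport η ∩ tsupport χ ⊆ Ω) (i : Fin d) :
    ∫ x, fderiv ℝ η x (EuclideanSpace.single i 1) • (χ x • u x) ∂(vol Ω) =
      -∫ x, η x • (χ x • G x i + fderiv ℝ χ x (EuclideanSpace.single i 1) • u x) ∂(vol Ω) := by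
  set e : E d := EuclideanSpace.single i 1
  have hui := MemLp.integrable_vol hΩb hu
  have hGi := MemLp.integrable_vol hΩb (memLp_apply h.1 i)
  have hη1 : ContDiff ℝ 1 η := hη.of_le (by norm_num)
  have hχ1 : ContDiff ℝ 1 χ := hχ.of_le (by norm_num)
  have hdη : Continuous fun x => fderiv ℝ η x e :=
    (hη1.continuous_fderiv one_ne_zero).clm_apply continuous_const
  have hdχ : Continuous fun x => fderiv ℝ χ x e :=
    (hχ1.continuous_fderiv one_ne_zero).clm_apply continuous_const
  -- Only the product `η χ` has to be an admissible test function; `η` itself may reach outside `Ω`.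
  have key := h.2 (fun x => η x * χ x) (hη.mul hχ) hηc.mul_right
    ((Set.subset_inter tsupport_mul_subset_left tsupport_mul_subset_right).trans hs) i
  have hd : ∀ x, fderiv ℝ (fun x => η x * χ x) x e =
      η x * fderiv ℝ χ x e + fderiv ℝ η x e * χ x := by
    intro x
    have h1 : HasFDerivAt (fun x => η x * χ x) _ x :=
      (hη1.differentiable one_ne_zero x).hasFDerivAt.mul
        (hχ1.differentiable one_ne_zero x).hasFDerivAt
    rw [h1.fderiv]
    simp [mul_comm]
  have hA : Integrable (fun x => (η x * fderiv ℝ χ x e) • u x) (vol Ω) :=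
    integrable_smul_of_compact hui (hη1.continuous.mul hdχ) hηc.mul_right
  have hB : Integrable (fun x => (fderiv ℝ η x e * χ x) • u x) (vol Ω) :=
    integrable_smul_of_compact hui (hdη.mul hχ1.continuous) (hηc.fderiv_apply ℝ e).mul_right
  have hC : Integrable (fun x => (η x * χ x) • G x i) (vol Ω) :=
    integrable_smul_of_compact hGi (hη1.continuous.mul hχ1.continuous) hηc.mul_right
  change ∫ x, fderiv ℝ (fun x => η x * χ x) x e • u x ∂(vol Ω) = _ at key
  simp only [hd, add_smul] at key
  rw [integral_add hA hB] at key
  simp only [smul_add, smul_smul]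
  rw [integral_add hC hA, neg_add, ← key]
  ring

/-- The gradient of a real function as a complex vector. -/
def cgrad (χ : E d → ℝ) (x : E d) : EuclideanSpace ℂ (Fin d) :=
  WithLp.toLp 2 fun i => ((fderiv ℝ χ x (EuclideanSpace.single i 1) : ℝ) : ℂ)

theorem continuous_cgrad {χ : E d → ℝ} (hχ : ContDiff ℝ 1 χ) : Continuous (cgrad χ) := by
  have : Continuous fun x => fun i => ((fderiv ℝ χ x (EuclideanSpace.single i (1 : ℝ)) : ℝ) : ℂ) :=
    continuous_pi fun i => Complex.continuous_ofReal.comp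
      ((hχ.continuous_fderiv one_ne_zero).clm_apply continuous_const)
  exact (PiLp.continuous_toLp 2 _).comp this

theorem hasCompactSupport_cgrad {χ : E d → ℝ} (hχ : HasCompactSupport χ) :
    HasCompactSupport (cgrad χ) := by
  refine hχ.mono' fun x hx => ?_
  by_contra hxs
  have h2 : fderiv ℝ χ x = 0 := image_eq_zero_of_notMem_tsupport
    fun h => hxs (tsupport_fderiv_subset ℝ h)
  exact hx (by ext i; simp [cgrad, h2])

/-- The gradient of a convolution with a smooth kernel. -/
theorem fderiv_convolution_apply {k : E d → ℝ} (hk : ContDiff ℝ 1 k) (hkc : HasCompactSupport k)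
    {f : E d → ℂ} (hf : LocallyIntegrable f volume) (x v : E d) :
    fderiv ℝ (convolution k f (ContinuousLinearMap.lsmul ℝ ℝ) volume) x v =
      ∫ w, fderiv ℝ k (x - w) v • f w := by
  have h := hkc.hasFDerivAt_convolution_left (ContinuousLinearMap.lsmul ℝ ℝ) hk hf x
  have hex := (hkc.fderiv ℝ).convolutionExists_left
    (ContinuousLinearMap.precompL (E d) (ContinuousLinearMap.lsmul ℝ ℝ : ℝ →L[ℝ] ℂ →L[ℝ] ℂ))
    (hk.continuous_fderiv one_ne_zero) hf x
  have h2 := ContinuousLinearMap.integral_apply hex v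
  rw [h.fderiv]
  refine h2.trans ?_
  rw [← integral_sub_left_eq_self _ _ x]
  refine integral_congr_ae (Eventually.of_forall fun w => ?_)
  simp only [ContinuousLinearMap.precompL_apply, ContinuousLinearMap.lsmul_apply, sub_sub_cancel]

/-- The gradient at `x` of a mollification of `χ u`, if the kernel only sees points of `Ω`. -/
theorem grad_convolution_eq {Ω : Set (E d)} (hΩo : IsOpen Ω) (hΩb : Bornology.IsBounded Ω)
    {u : E d → ℂ} {G : E d → EuclideanSpace ℂ (Fin d)} (hu : MemLp u 2 (vol Ω))
    (h : IsWeakGrad Ω u G) {χ : E d → ℝ} (hχ : ContDiff ℝ ∞ χ) {k : E d → ℝ}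
    (hkC : ContDiff ℝ ∞ k) (hkc : HasCompactSupport k)
    (hlocf : LocallyIntegrable (Ω.indicator fun x => χ x • u x) volume)
    (hlocH : LocallyIntegrable (Ω.indicator fun x => χ x • G x + u x • cgrad χ x) volume)
    {x : E d} (hs : ∀ w, x - w ∈ tsupport k → w ∈ tsupport χ → w ∈ Ω) :
    grad (convolution k (Ω.indicator fun x => χ x • u x) (ContinuousLinearMap.lsmul ℝ ℝ) volume) x =
      convolution k (Ω.indicator fun x => χ x • G x + u x • cgrad χ x)
        (ContinuousLinearMap.lsmul ℝ ℝ) volume x := by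
  have hΩm := hΩo.measurableSet
  have hk1 : ContDiff ℝ 1 k := hkC.of_le (by norm_num)
  set f : E d → ℂ := Ω.indicator fun x => χ x • u x with hf
  set H : E d → EuclideanSpace ℂ (Fin d) := fun x => χ x • G x + u x • cgrad χ x with hH
  set Hf : E d → EuclideanSpace ℂ (Fin d) := Ω.indicator H with hHf
  ext i
  -- Differentiating the convolution puts the derivative on the reflected kernel, which thus becomes
  -- the test function in the product rule for `χ u`.
  set η : E d → ℝ := fun w => k (x - w) with hη
  have hηC : ContDiff ℝ ∞ η := hkC.comp (contDiff_const.sub contDiff_id)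
  have hηc : HasCompactSupport η := hkc.comp_homeomorph (Homeomorph.subLeft x)
  have hηs : tsupport η ∩ tsupport χ ⊆ Ω := by
    rintro w ⟨hw1, hw2⟩
    refine hs w ?_ hw2
    have h1 : x - w ∈ tsupport k := by
      have h2 : tsupport η ⊆ (fun w => x - w) ⁻¹' tsupport k :=
        closure_minimal (fun y hy => subset_tsupport k hy)
          ((isClosed_tsupport k).preimage (by fun_prop))
      exact h2 hw1
    exact h1
  have hηd : ∀ w, fderiv ℝ η w (EuclideanSpace.single i 1) =
      -fderiv ℝ k (x - w) (EuclideanSpace.single i 1) := by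
    intro w
    have h1 : HasFDerivAt η _ w :=
      (hk1.differentiable one_ne_zero (x - w)).hasFDerivAt.comp w ((hasFDerivAt_id w).const_sub x)
    rw [h1.fderiv]
    simp
  have hint := IsWeakGrad.integral_mul hΩb hu h hχ hηC hηc hηs i
  have hexH : Integrable (fun w => η w • Hf w) volume := by
    have h1 : Integrable (fun t => k t • Hf (x - t)) volume :=
      hkc.convolutionExists_left (ContinuousLinearMap.lsmul ℝ ℝ) hk1.continuous hlocH x
    have h2 := h1.comp_sub_left x
    simpa using h2
  change fderiv ℝ (convolution k f (ContinuousLinearMap.lsmul ℝ ℝ) volume) x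
    (EuclideanSpace.single i 1) = _
  rw [fderiv_convolution_apply hk1 hkc hlocf, convolution_eq_swap]
  have hR : (∫ w, (ContinuousLinearMap.lsmul ℝ ℝ) (k (x - w)) (Hf w)) i =
      ∫ w, η w • Hf w i := by
    have := (EuclideanSpace.proj i : EuclideanSpace ℂ (Fin d) →L[ℂ] ℂ).integral_comp_comm hexH
    exact this.symm
  rw [hR]
  have hL : ∫ w, fderiv ℝ k (x - w) (EuclideanSpace.single i 1) • f w =
      -∫ w, fderiv ℝ η w (EuclideanSpace.single i 1) • (χ w • u w) ∂(vol Ω) := by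
    rw [vol, ← integral_indicator hΩm, ← integral_neg]
    refine integral_congr_ae (Eventually.of_forall fun w => ?_)
    by_cases hw : w ∈ Ω <;> simp [hf, hw, hηd]
  rw [hL, hint, neg_neg, vol, ← integral_indicator hΩm]
  refine integral_congr_ae (Eventually.of_forall fun w => ?_)
  have hHi : H w i = χ w • G w i + u w * ((fderiv ℝ χ w (EuclideanSpace.single i 1) : ℝ) : ℂ) := rfl
  by_cases hw : w ∈ Ω
  · simp only [hHf, Set.indicator_of_mem hw, hHi, Complex.real_smul]
    ring
  · simp only [hHf, Set.indicator_of_notMem hw, PiLp.zero_apply, smul_zero]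

/-- The extension of `χ u` by zero need not be weakly differentiable across `∂Ω`. A kernel supported
in the ball of radius `c τ` around `τ e` avoids this: by `hcone`, at `x ∈ Ω` it meets the support of
`χ` only inside `Ω`, so there gradient and mollification commute. -/
theorem exists_approx_of_localized {Ω : Set (E d)} (hΩo : IsOpen Ω)
    (hΩb : Bornology.IsBounded Ω) {u : E d → ℂ} {G : E d → EuclideanSpace ℂ (Fin d)}
    (hu : MemLp u 2 (vol Ω)) (h : IsWeakGrad Ω u G) (hum : StronglyMeasurable u)
    (hGm : StronglyMeasurable G) {χ : E d → ℝ} (hχ : ContDiff ℝ ∞ χ) (hχc : HasCompactSupport χ)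
    {e : E d} {c τ₀ : ℝ} (hc : 0 < c) (hτ₀ : 0 < τ₀)
    (hcone : ∀ τ, 0 < τ → τ < τ₀ → ∀ x ∈ Ω, ∀ w ∈ tsupport χ, ‖x - w - τ • e‖ ≤ c * τ → w ∈ Ω)
    {ε : ℝ≥0∞} (hε : 0 < ε) :
    ∃ φ : E d → ℂ, ContDiff ℝ 1 φ ∧ eLpNorm (fun x => φ x - χ x • u x) 2 (vol Ω) ≤ ε ∧
      eLpNorm (fun x => grad φ x - (χ x • G x + u x • cgrad χ x)) 2 (vol Ω) ≤ ε := by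
  have hχ1 : ContDiff ℝ 1 χ := hχ.of_le (by norm_num)
  have hΩm := hΩo.measurableSet
  set H : E d → EuclideanSpace ℂ (Fin d) := fun x => χ x • G x + u x • cgrad χ x with hH
  set f : E d → ℂ := Ω.indicator fun x => χ x • u x with hf
  set Hf : E d → EuclideanSpace ℂ (Fin d) := Ω.indicator H with hHf
  have hχtop : MemLp χ ⊤ (vol Ω) := hχ1.continuous.memLp_top_of_hasCompactSupport hχc _
  have hgtop : MemLp (cgrad χ) ⊤ (vol Ω) :=
    (continuous_cgrad hχ1).memLp_top_of_hasCompactSupport (hasCompactSupport_cgrad hχc) _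
  have hfL : MemLp f 2 volume := (memLp_indicator_iff_restrict hΩm).mpr (hu.smul hχtop)
  have hHL : MemLp Hf 2 volume :=
    (memLp_indicator_iff_restrict hΩm).mpr ((h.1.smul hχtop).add (hgtop.smul hu))
  have hfm : StronglyMeasurable f :=
    (hχ1.continuous.stronglyMeasurable.smul hum).indicator hΩm
  have hHm : StronglyMeasurable Hf :=
    ((hχ1.continuous.stronglyMeasurable.smul hGm).add
      (hum.smul (continuous_cgrad hχ1).stronglyMeasurable)).indicator hΩm
  obtain ⟨δ₁, hδ₁, hT₁⟩ := exists_eLpNorm_translate_sub_le hfL hε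
  obtain ⟨δ₂, hδ₂, hT₂⟩ := exists_eLpNorm_translate_sub_le hHL hε
  have hec : 0 < ‖e‖ + c := by positivity
  -- The kernel lives within distance `(‖e‖ + c) τ` of the origin, so every translation involved is
  -- shorter than `δ₁` and `δ₂`.
  obtain ⟨τ, hτ, hτlt⟩ := exists_between (show (0 : ℝ) < min τ₀ (min δ₁ δ₂ / (‖e‖ + c)) by positivity)
  have hττ₀ : τ < τ₀ := hτlt.trans_le (min_le_left _ _)
  have hτδ : (‖e‖ + c) * τ < min δ₁ δ₂ := by
    have := hτlt.trans_le (min_le_right _ _)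
    rwa [lt_div_iff₀ hec, mul_comm] at this
  let B : ContDiffBump (τ • e) := ⟨c * τ / 2, c * τ, by positivity, by
    have : 0 < c * τ := by positivity
    linarith⟩
  set k : E d → ℝ := B.normed volume with hk
  have hkC : ContDiff ℝ ∞ k := B.contDiff_normed
  have hk1 : ContDiff ℝ 1 k := hkC.of_le (by norm_num)
  have hkc : HasCompactSupport k := B.hasCompactSupport_normed
  have hkt : tsupport k = Metric.closedBall (τ • e) (c * τ) := B.tsupport_normed_eq
  have hksmall : ∀ w, k w ≠ 0 → ‖w‖ < min δ₁ δ₂ := by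
    intro w hw
    have h1 : w ∈ Function.support k := hw
    rw [hk, B.support_normed_eq, mem_ball_iff_norm] at h1
    calc ‖w‖ = ‖(w - τ • e) + τ • e‖ := by rw [sub_add_cancel]
      _ ≤ c * τ + ‖e‖ * τ := by
          refine (norm_add_le _ _).trans (add_le_add h1.le ?_)
          rw [norm_smul, Real.norm_of_nonneg hτ.le, mul_comm]
      _ < min δ₁ δ₂ := by linarith
  have hlocf : LocallyIntegrable f volume := hfL.locallyIntegrable (by norm_num)
  have hlocH : LocallyIntegrable Hf volume := hHL.locallyIntegrable (by norm_num)
  refine ⟨convolution k f (ContinuousLinearMap.lsmul ℝ ℝ) volume, ?_, ?_, ?_⟩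
  · exact_mod_cast hkc.contDiff_convolution_left (n := 1) (ContinuousLinearMap.lsmul ℝ ℝ)
      (by exact_mod_cast hk1) hlocf
  · refine le_trans ?_ (eLpNorm_convolution_sub_le hfL hfm hk1.continuous hkc B.nonneg_normed
      B.integral_normed fun w hw => hT₁ w ((hksmall w hw).trans_le (min_le_left _ _)))
    refine le_trans (le_of_eq ?_) (eLpNorm_mono_measure _ (Measure.restrict_le_self : vol Ω ≤ volume))
    refine eLpNorm_congr_ae ?_
    filter_upwards [ae_restrict_mem hΩm] with x hx
    rw [hf, Set.indicator_of_mem hx]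
  · refine le_trans ?_ (eLpNorm_convolution_sub_le hHL hHm hk1.continuous hkc B.nonneg_normed
      B.integral_normed fun w hw => hT₂ w ((hksmall w hw).trans_le (min_le_right _ _)))
    refine le_trans (le_of_eq ?_) (eLpNorm_mono_measure _ (Measure.restrict_le_self : vol Ω ≤ volume))
    refine eLpNorm_congr_ae ?_
    filter_upwards [ae_restrict_mem hΩm] with x hx
    rw [hHf, Set.indicator_of_mem hx]
    congr 1
    refine grad_convolution_eq hΩo hΩb hu h hχ hkC hkc hlocf hlocH fun w hw1 hw2 => ?_
    refine hcone τ hτ hττ₀ x hx w hw2 ?_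
    rwa [hkt, mem_closedBall_iff_norm] at hw1

/-- `C¹(ℝᵈ)` is dense in `H¹(Ω)` for a bounded Lipschitz domain. -/
theorem exists_contDiff_approx {Ω : Set (E d)} (hΩ : IsBoundedLipschitzDomain Ω) {u : E d → ℂ}
    {G : E d → EuclideanSpace ℂ (Fin d)} (hu : MemLp u 2 (vol Ω)) (h : IsWeakGrad Ω u G)
    {ε : ℝ≥0∞} (hε : 0 < ε) :
    ∃ φ : E d → ℂ, ContDiff ℝ 1 φ ∧ eLpNorm (fun x => φ x - u x) 2 (vol Ω) ≤ ε ∧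
      eLpNorm (fun x => grad φ x - G x) 2 (vol Ω) ≤ ε := by
  -- Genuinely measurable representatives are needed for the Tonelli argument in the mollification
  -- estimate.
  wlog hm : StronglyMeasurable u ∧ StronglyMeasurable G generalizing u G
  · have hu' := hu.1.ae_eq_mk
    have hG' := h.1.1.ae_eq_mk
    obtain ⟨φ, h1, h2, h3⟩ := this (hu.ae_eq hu') (h.congr hu' hG')
      ⟨hu.1.stronglyMeasurable_mk, h.1.1.stronglyMeasurable_mk⟩
    refine ⟨φ, h1, le_trans (le_of_eq ?_) h2, le_trans (le_of_eq ?_) h3⟩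
    · refine eLpNorm_congr_ae ?_
      filter_upwards [hu'] with x hx
      rw [hx]
    · refine eLpNorm_congr_ae ?_
      filter_upwards [hG'] with x hx
      rw [hx]
  have hcone : ∀ z, ∃ V : Set (E d), z ∈ closure Ω → IsOpen V ∧ z ∈ V ∧ ∃ e : E d, ∃ c > 0,
      ∀ S ⊆ V, IsCompact S → ∃ τ₀ > 0, ∀ τ, 0 < τ → τ < τ₀ → ∀ x ∈ Ω, ∀ w ∈ S,
        ‖x - w - τ • e‖ ≤ c * τ → w ∈ Ω := by
    intro z
    by_cases hz : z ∈ closure Ω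
    · obtain ⟨V, hV⟩ := exists_inward_cone hΩ hz
      exact ⟨V, fun _ => hV⟩
    · exact ⟨∅, fun h => absurd h hz⟩
  choose V hV using hcone
  obtain ⟨t, ht, χ, hχ, hχ1, -⟩ := exists_finset_smooth_partition
    hΩ.isBounded.isCompact_closure (V := V) fun z hz => ⟨(hV z hz).1, (hV z hz).2.1⟩
  have hε' : 0 < ε / (t.card + 1 : ℝ≥0∞) := ENNReal.div_pos hε.ne' (by finiteness)
  have hloc : ∀ z, ∃ φ : E d → ℂ, z ∈ t → ContDiff ℝ 1 φ ∧
      eLpNorm (fun x => φ x - χ z x • u x) 2 (vol Ω) ≤ ε / (t.card + 1 : ℝ≥0∞) ∧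
      eLpNorm (fun x => grad φ x - (χ z x • G x + u x • cgrad (χ z) x)) 2 (vol Ω) ≤
        ε / (t.card + 1 : ℝ≥0∞) := by
    intro z
    by_cases hz : z ∈ t
    · obtain ⟨h1, h2, h3, -⟩ := hχ z hz
      obtain ⟨-, -, e, c, hc, hS⟩ := hV z (ht z hz)
      obtain ⟨τ₀, hτ₀, hcone⟩ := hS _ h3 h2
      obtain ⟨φ, hφ⟩ := exists_approx_of_localized hΩ.isOpen hΩ.isBounded hu h hm.1 hm.2 h1 h2 hc hτ₀
        hcone hε'
      exact ⟨φ, fun _ => hφ⟩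
    · exact ⟨0, fun h => absurd h hz⟩
  choose φ hφ using hloc
  have hcard : ∀ {a : E d → ℝ≥0∞}, (∀ z ∈ t, a z ≤ ε / (t.card + 1 : ℝ≥0∞)) →
      ∑ z ∈ t, a z ≤ ε := by
    intro a ha
    refine (Finset.sum_le_card_nsmul _ _ _ ha).trans ?_
    rw [nsmul_eq_mul, ← mul_div_assoc]
    refine ENNReal.div_le_of_le_mul ?_
    rw [mul_comm]
    gcongr
    exact le_self_add
  have hΩm := hΩ.isOpen.measurableSet
  have hφc : ∀ z ∈ t, Continuous (φ z) := fun z hz => (hφ z hz).1.continuous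
  refine ⟨fun x => ∑ z ∈ t, φ z x, ContDiff.sum fun z hz => (hφ z hz).1, ?_, ?_⟩
  · refine le_trans (le_of_eq ?_) ((eLpNorm_sum_le (f := fun z x => φ z x - χ z x • u x)
      (fun z hz => ?_) (by norm_num)).trans (hcard fun z hz => (hφ z hz).2.1))
    · refine eLpNorm_congr_ae ?_
      filter_upwards [ae_restrict_mem hΩm] with x hx
      simp only [Finset.sum_apply, Finset.sum_sub_distrib]
      rw [← Finset.sum_smul, hχ1 x (subset_closure hx), one_smul]
    · exact (hφc z hz).aestronglyMeasurable.sub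
        ((hχ z hz).1.continuous.aestronglyMeasurable.smul hm.1.aestronglyMeasurable)
  · refine le_trans (le_of_eq ?_) ((eLpNorm_sum_le
      (f := fun z x => grad (φ z) x - (χ z x • G x + u x • cgrad (χ z) x))
      (fun z hz => ?_) (by norm_num)).trans (hcard fun z hz => (hφ z hz).2.2))
    · refine eLpNorm_congr_ae ?_
      filter_upwards [ae_restrict_mem hΩm] with x hx
      have hχd : ∀ z ∈ t, DifferentiableAt ℝ (χ z) x := fun z hz =>
        ((hχ z hz).1.of_le (m := 1) (by norm_num)).differentiable one_ne_zero x
      -- The cutoffs sum to `1` on the open set `Ω`, so the product rule terms `u ∇χ` cancel there.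
      have hχsum : ∑ z ∈ t, fderiv ℝ (χ z) x = 0 := by
        rw [← fderiv_fun_sum hχd]
        have hev : (fun y => ∑ z ∈ t, χ z y) =ᶠ[𝓝 x] fun _ => (1 : ℝ) := by
          filter_upwards [hΩ.isOpen.mem_nhds hx] with y hy using hχ1 y (subset_closure hy)
        rw [hev.fderiv_eq]
        simp
      have hcg : ∑ z ∈ t, cgrad (χ z) x = 0 := by
        ext i
        have := congrArg (fun A => ((A (EuclideanSpace.single i 1) : ℝ) : ℂ)) hχsum
        simpa [cgrad, Finset.sum_apply] using this
      have hgr : grad (fun x => ∑ z ∈ t, φ z x) x = ∑ z ∈ t, grad (φ z) x := by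
        ext i
        simp only [grad]
        rw [fderiv_fun_sum fun z hz => (hφ z hz).1.differentiable one_ne_zero x]
        simp [Finset.sum_apply]
      simp only [Finset.sum_apply, Finset.sum_sub_distrib, Finset.sum_add_distrib]
      rw [← Finset.sum_smul, ← Finset.smul_sum, hχ1 x (subset_closure hx), one_smul, hcg, smul_zero,
        add_zero, hgr]
    · exact (continuous_grad (hφ z hz).1).aestronglyMeasurable.sub
        (((hχ z hz).1.continuous.aestronglyMeasurable.smul hm.2.aestronglyMeasurable).add
          (hm.1.aestronglyMeasurable.smul (continuous_cgrad
            ((hχ z hz).1.of_le (by norm_num))).aestronglyMeasurable))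

end Density

/-! ### The Sobolev space with traces as a Hilbert space -/

section TracedSobolev

variable {d : ℕ} {Ω : Set (E d)}

/-- `L²(Ω; ℂᵈ)`. -/
abbrev L2Vec (Ω : Set (E d)) := Lp (EuclideanSpace ℂ (Fin d)) 2 (vol Ω)

/-- `L²(∂Ω)`. -/
abbrev L2Surf (Ω : Set (E d)) := Lp ℂ 2 (surf Ω)

/-- Triples of a function, its gradient and its boundary values. -/
abbrev TraceTriple (Ω : Set (E d)) := WithLp 2 (L2 Ω × WithLp 2 (L2Vec Ω × L2Surf Ω))

theorem memLp_vol_of_continuous {F : Type*} [NormedAddCommGroup F]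
    (hΩ : IsBoundedLipschitzDomain Ω) {f : E d → F} (hf : Continuous f) : MemLp f 2 (vol Ω) := by
  have := isFiniteMeasure_vol hΩ.isBounded
  obtain ⟨C, hC⟩ := hΩ.isBounded.isCompact_closure.exists_bound_of_continuousOn hf.continuousOn
  have hmeas : AEStronglyMeasurable f (vol Ω) :=
    hf.continuousOn.aestronglyMeasurable hΩ.isOpen.measurableSet
  refine MemLp.of_bound hmeas C ?_
  filter_upwards [ae_restrict_mem hΩ.isOpen.measurableSet] with x hx using hC x (subset_closure hx)

/-- Square integrability on the boundary is itself a consequence of the trace inequality, whose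
right-hand side is finite. -/
theorem TraceInequality.memLp_surf {C₁ C₂ : ℝ} (hT : TraceInequality Ω C₁ C₂)
    (hΩ : IsBoundedLipschitzDomain Ω) {φ : E d → ℂ} (hφ : ContDiff ℝ 1 φ) :
    MemLp φ 2 (surf Ω) := by
  refine ⟨hφ.continuous.aestronglyMeasurable, ?_⟩
  have h1 := (memLp_vol_of_continuous hΩ hφ.continuous).eLpNorm_ne_top
  have h2 := (memLp_vol_of_continuous hΩ (continuous_grad hφ)).eLpNorm_ne_top
  have h3 : eLpNorm φ 2 (surf Ω) ^ 2 < ⊤ := (hT φ hφ).trans_lt (by finiteness)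
  by_contra h
  rw [not_lt, top_le_iff] at h
  rw [h] at h3
  simp at h3

/-- The triples `(φ, ∇φ, φ|_∂Ω)` with `φ ∈ C¹(ℝᵈ)`. -/
def smoothTriples (Ω : Set (E d)) : Submodule ℂ (TraceTriple Ω) where
  carrier := {p | ∃ φ : E d → ℂ, ContDiff ℝ 1 φ ∧ p.fst =ᵐ[vol Ω] φ ∧
    p.snd.fst =ᵐ[vol Ω] grad φ ∧ p.snd.snd =ᵐ[surf Ω] φ}
  zero_mem' := by
    refine ⟨0, contDiff_const, Lp.coeFn_zero _ _ _, ?_, Lp.coeFn_zero _ _ _⟩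
    refine (Lp.coeFn_zero _ _ _).trans (Eventually.of_forall fun x => ?_)
    ext i
    simp [grad]
  add_mem' := by
    rintro p q ⟨φ, hφ, h1, h2, h3⟩ ⟨ψ, hψ, k1, k2, k3⟩
    refine ⟨φ + ψ, hφ.add hψ, (Lp.coeFn_add _ _).trans (h1.add k1), ?_,
      (Lp.coeFn_add _ _).trans (h3.add k3)⟩
    refine ((Lp.coeFn_add _ _).trans (h2.add k2)).trans (Eventually.of_forall fun x => ?_)
    ext i
    simp [grad, fderiv_add (hφ.differentiable one_ne_zero x) (hψ.differentiable one_ne_zero x)]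
  smul_mem' := by
    rintro c p ⟨φ, hφ, h1, h2, h3⟩
    refine ⟨c • φ, hφ.const_smul c, (Lp.coeFn_smul _ _).trans (h1.const_smul c), ?_,
      (Lp.coeFn_smul _ _).trans (h3.const_smul c)⟩
    refine ((Lp.coeFn_smul _ _).trans (h2.const_smul c)).trans (Eventually.of_forall fun x => ?_)
    ext i
    simp [grad, fderiv_const_smul (hφ.differentiable one_ne_zero x)]

/-- `H¹(Ω)` as a Hilbert space of triples `(u, ∇u, tr u)`. -/
def tracedSobolev (Ω : Set (E d)) : Submodule ℂ (TraceTriple Ω) :=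
  (smoothTriples Ω).topologicalClosure

instance : CompleteSpace (tracedSobolev Ω) :=
  (Submodule.isClosed_topologicalClosure _).completeSpace_coe

theorem TraceInequality.exists_smoothTriple {C₁ C₂ : ℝ} (hT : TraceInequality Ω C₁ C₂)
    (hΩ : IsBoundedLipschitzDomain Ω) {φ : E d → ℂ} (hφ : ContDiff ℝ 1 φ) :
    ∃ p ∈ smoothTriples Ω, p.fst =ᵐ[vol Ω] φ ∧ p.snd.fst =ᵐ[vol Ω] grad φ ∧
      p.snd.snd =ᵐ[surf Ω] φ := by
  have h1 := (memLp_vol_of_continuous hΩ hφ.continuous).coeFn_toLp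
  have h2 := (memLp_vol_of_continuous hΩ (continuous_grad hφ)).coeFn_toLp
  have h3 := (hT.memLp_surf hΩ hφ).coeFn_toLp
  exact ⟨WithLp.toLp 2 ((memLp_vol_of_continuous hΩ hφ.continuous).toLp φ, WithLp.toLp 2
    ((memLp_vol_of_continuous hΩ (continuous_grad hφ)).toLp (grad φ),
      (hT.memLp_surf hΩ hφ).toLp φ)), ⟨φ, hφ, h1, h2, h3⟩, h1, h2, h3⟩

theorem continuous_triple_fst : Continuous fun p : TraceTriple Ω => p.fst := by fun_prop

theorem continuous_triple_grad : Continuous fun p : TraceTriple Ω => p.snd.fst := by fun_prop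

theorem continuous_triple_trace : Continuous fun p : TraceTriple Ω => p.snd.snd := by fun_prop

/-- The trace inequality on `H¹(Ω)`. -/
theorem TraceInequality.norm_trace_sq_le {C₁ C₂ : ℝ} (hC₁ : 0 ≤ C₁) (hC₂ : 0 ≤ C₂)
    (hT : TraceInequality Ω C₁ C₂) {p : TraceTriple Ω} (hp : p ∈ tracedSobolev Ω) :
    ‖p.snd.snd‖ ^ 2 ≤ C₁ * (‖p.snd.fst‖ * ‖p.fst‖) + C₂ * ‖p.fst‖ ^ 2 := by
  have c1 := continuous_triple_fst (Ω := Ω)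
  have c2 := continuous_triple_grad (Ω := Ω)
  have c3 := continuous_triple_trace (Ω := Ω)
  have hcl : IsClosed {p : TraceTriple Ω |
      ‖p.snd.snd‖ ^ 2 ≤ C₁ * (‖p.snd.fst‖ * ‖p.fst‖) + C₂ * ‖p.fst‖ ^ 2} :=
    isClosed_le (c3.norm.pow 2)
      ((continuous_const.mul (c2.norm.mul c1.norm)).add (continuous_const.mul (c1.norm.pow 2)))
  refine closure_minimal ?_ hcl hp
  rintro p ⟨φ, hφ, h1, h2, h3⟩
  have h := hT φ hφ
  rw [← eLpNorm_congr_ae h1, ← eLpNorm_congr_ae h2, ← eLpNorm_congr_ae h3] at h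
  have e1 : ∀ {F : Type} [NormedAddCommGroup F] {μ : Measure (E d)} (f : Lp F 2 μ),
      eLpNorm f 2 μ = ENNReal.ofReal ‖f‖ := fun f => by
    rw [Lp.norm_def, ENNReal.ofReal_toReal (Lp.eLpNorm_ne_top f)]
  rw [e1, e1, e1, ← ENNReal.ofReal_mul (norm_nonneg _), ← ENNReal.ofReal_mul hC₁,
    ← ENNReal.ofReal_pow (norm_nonneg _), ← ENNReal.ofReal_pow (norm_nonneg _),
    ← ENNReal.ofReal_mul hC₂, ← ENNReal.ofReal_add (by positivity) (by positivity),
    ENNReal.ofReal_le_ofReal_iff (by positivity)] at h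
  change ‖p.snd.snd‖ ^ 2 ≤ _
  rw [mul_comm ‖p.snd.fst‖]
  exact h

/-- `C¹` functions are weakly differentiable. -/
theorem isWeakGrad_grad (hΩ : IsBoundedLipschitzDomain Ω) {φ : E d → ℂ} (hφ : ContDiff ℝ 1 φ) :
    IsWeakGrad Ω φ (grad φ) := by
  refine ⟨memLp_vol_of_continuous hΩ (continuous_grad hφ), fun η hη hηc hηs i => ?_⟩
  set e : E d := EuclideanSpace.single i 1 with he
  have hη1 : ContDiff ℝ 1 η := hη.of_le (by norm_num)
  have hout : ∀ {x}, x ∉ Ω → η x = 0 ∧ fderiv ℝ η x e = 0 := by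
    intro x hx
    have h1 : x ∉ tsupport η := fun h => hx (hηs h)
    have h2 : fderiv ℝ η x = 0 :=
      image_eq_zero_of_notMem_tsupport fun h => h1 (tsupport_fderiv_subset ℝ h)
    exact ⟨image_eq_zero_of_notMem_tsupport h1, by simp [h2]⟩
  have hdη : Continuous fun x => fderiv ℝ η x e :=
    (hη1.continuous_fderiv one_ne_zero).clm_apply continuous_const
  have hdφ : Continuous fun x => fderiv ℝ φ x e :=
    (hφ.continuous_fderiv one_ne_zero).clm_apply continuous_const
  have hparts := integral_smul_fderiv_eq_neg_fderiv_smul_of_integrable (μ := volume) (f := η)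
    (g := φ) (v := e)
    ((hdη.smul hφ.continuous).integrable_of_hasCompactSupport (hηc.fderiv_apply ℝ e).smul_right)
    ((hη1.continuous.smul hdφ).integrable_of_hasCompactSupport hηc.smul_right)
    ((hη1.continuous.smul hφ.continuous).integrable_of_hasCompactSupport hηc.smul_right)
    (fun x _ => hη1.differentiable one_ne_zero x) (fun x _ => hφ.differentiable one_ne_zero x)
  have h1 : ∫ x, fderiv ℝ η x e • φ x ∂(vol Ω) = ∫ x, fderiv ℝ η x e • φ x :=
    setIntegral_eq_integral_of_forall_compl_eq_zero fun x hx => by rw [(hout hx).2, zero_smul]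
  have h2 : ∫ x, η x • grad φ x i ∂(vol Ω) = ∫ x, η x • fderiv ℝ φ x e :=
    setIntegral_eq_integral_of_forall_compl_eq_zero fun x hx => by rw [(hout hx).1, zero_smul]
  rw [h1, h2, hparts, neg_neg]

/-- Weak gradients are unique. -/
theorem IsWeakGrad.ae_eq (hΩ : IsBoundedLipschitzDomain Ω) {u : E d → ℂ}
    {G G' : E d → EuclideanSpace ℂ (Fin d)} (h : IsWeakGrad Ω u G) (h' : IsWeakGrad Ω u G') :
    G =ᵐ[vol Ω] G' := by
  have hi : ∀ i, ∀ᵐ x ∂(vol Ω), G x i = G' x i := by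
    intro i
    have hG := MemLp.integrable_vol hΩ.isBounded (memLp_apply h.1 i)
    have hG' := MemLp.integrable_vol hΩ.isBounded (memLp_apply h'.1 i)
    have h0 := hΩ.isOpen.ae_eq_zero_of_integral_contDiff_smul_eq_zero
      (f := fun x => G x i - G' x i) (μ := vol Ω) ((hG.sub hG').locallyIntegrable.locallyIntegrableOn _)
      fun η hη hηc hηs => by
        have h1 := h.2 η hη hηc hηs i
        have h2 := h'.2 η hη hηc hηs i
        simp only [smul_sub]
        rw [integral_sub (integrable_smul_of_compact hG hη.continuous hηc)
          (integrable_smul_of_compact hG' hη.continuous hηc), sub_eq_zero]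
        exact neg_injective (h1.symm.trans h2)
    filter_upwards [h0, ae_restrict_mem hΩ.isOpen.measurableSet] with x hx hxΩ
    exact sub_eq_zero.mp (hx hxΩ)
  filter_upwards [ae_all_iff.mpr hi] with x hx
  ext i
  exact hx i

theorem MemH1.isWeakGrad_weakGrad {u : E d → ℂ} (hu : MemH1 Ω u) :
    IsWeakGrad Ω u (weakGrad Ω u) :=
  Classical.epsilon_spec hu.2

/-- Elements of the Hilbert space are functions together with their weak gradients. -/
theorem isWeakGrad_of_mem_tracedSobolev (hΩ : IsBoundedLipschitzDomain Ω) {p : TraceTriple Ω}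
    (hp : p ∈ tracedSobolev Ω) : IsWeakGrad Ω p.fst p.snd.fst := by
  refine ⟨Lp.memLp _, fun η hη hηc hηs i => ?_⟩
  have : IsFiniteMeasure (vol Ω) := isFiniteMeasure_vol hΩ.isBounded
  have hη1 : ContDiff ℝ 1 η := hη.of_le (by norm_num)
  set a : E d → ℂ := fun x => ((fderiv ℝ η x (EuclideanSpace.single i 1) : ℝ) : ℂ) with ha
  set b : E d → EuclideanSpace ℂ (Fin d) := fun x => EuclideanSpace.single i ((η x : ℝ) : ℂ) with hb
  have hac : Continuous a := Complex.continuous_ofReal.comp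
    ((hη1.continuous_fderiv one_ne_zero).clm_apply continuous_const)
  have hbc : Continuous b := by
    have h1 : b = fun x => ((η x : ℝ) : ℂ) • EuclideanSpace.single i (1 : ℂ) := by
      ext x j
      simp [hb]
    rw [h1]
    exact (Complex.continuous_ofReal.comp hη.continuous).smul continuous_const
  have haL := memLp_vol_of_continuous hΩ hac
  have hbL := memLp_vol_of_continuous hΩ hbc
  have hA : ∀ u : L2 Ω, ∫ x, fderiv ℝ η x (EuclideanSpace.single i 1) • u x ∂(vol Ω) =
      inner ℂ (haL.toLp a) u := by
    intro u
    rw [L2.inner_def]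
    refine integral_congr_ae ?_
    filter_upwards [haL.coeFn_toLp] with x hx
    rw [hx, RCLike.inner_apply, ha]
    simp [mul_comm]
  have hB : ∀ G : L2Vec Ω, ∫ x, η x • G x i ∂(vol Ω) = inner ℂ (hbL.toLp b) G := by
    intro G
    rw [L2.inner_def]
    refine integral_congr_ae ?_
    filter_upwards [hbL.coeFn_toLp] with x hx
    rw [hx, hb, EuclideanSpace.inner_single_left]
    simp
  rw [hA, hB]
  -- Written as inner products with fixed `L²` functions, the defining identity of the weak gradient
  -- is a closed condition, so it passes from smooth triples to limits.
  have hcl : IsClosed {p : TraceTriple Ω |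
      inner ℂ (haL.toLp a) p.fst = -inner ℂ (hbL.toLp b) p.snd.fst} :=
    isClosed_eq (continuous_const.inner continuous_triple_fst)
      (continuous_const.inner continuous_triple_grad).neg
  refine closure_minimal ?_ hcl hp
  rintro q ⟨φ, hφ, h1, h2, -⟩
  have h := ((isWeakGrad_grad hΩ hφ).congr h1.symm h2.symm).2 η hη hηc hηs i
  rw [hA, hB] at h
  exact h

theorem memH1_of_mem_tracedSobolev (hΩ : IsBoundedLipschitzDomain Ω) {p : TraceTriple Ω}
    (hp : p ∈ tracedSobolev Ω) : p.fst ∈ H1 Ω :=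
  ⟨Lp.memLp _, _, isWeakGrad_of_mem_tracedSobolev hΩ hp⟩

theorem weakGrad_ae_eq (hΩ : IsBoundedLipschitzDomain Ω) {p : TraceTriple Ω}
    (hp : p ∈ tracedSobolev Ω) : weakGrad Ω p.fst =ᵐ[vol Ω] p.snd.fst :=
  IsWeakGrad.ae_eq hΩ (MemH1.isWeakGrad_weakGrad (memH1_of_mem_tracedSobolev hΩ hp))
    (isWeakGrad_of_mem_tracedSobolev hΩ hp)

theorem isTrace_of_mem_tracedSobolev (hΩ : IsBoundedLipschitzDomain Ω) {p : TraceTriple Ω}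
    (hp : p ∈ tracedSobolev Ω) : IsTrace Ω p.fst p.snd.snd := by
  refine ⟨Lp.memLp _, ?_⟩
  obtain ⟨q, hq, hlim⟩ := mem_closure_iff_seq_limit.mp
    (show p ∈ closure (smoothTriples Ω : Set (TraceTriple Ω)) from hp)
  choose φ hφ h1 h2 h3 using hq
  have l1 := (Lp.tendsto_Lp_iff_tendsto_eLpNorm' _ _).mp
    ((continuous_triple_fst (Ω := Ω)).continuousAt.tendsto.comp hlim)
  have l2 := (Lp.tendsto_Lp_iff_tendsto_eLpNorm' _ _).mp
    ((continuous_triple_grad (Ω := Ω)).continuousAt.tendsto.comp hlim)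
  have l3 := (Lp.tendsto_Lp_iff_tendsto_eLpNorm' _ _).mp
    ((continuous_triple_trace (Ω := Ω)).continuousAt.tendsto.comp hlim)
  refine ⟨φ, hφ, l1.congr fun n => eLpNorm_congr_ae ?_, l2.congr fun n => eLpNorm_congr_ae ?_,
    l3.congr fun n => eLpNorm_congr_ae ?_⟩
  · filter_upwards [h1 n] with x hx
    simp [hx]
  · filter_upwards [h2 n, weakGrad_ae_eq hΩ hp] with x hx hx'
    simp [hx, hx']
  · filter_upwards [h3 n] with x hx
    simp [hx]

/-- An approximating sequence as in `IsTrace` is a convergent sequence of smooth triples. This holds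
for every admissible trace, hence for the one chosen by `trace`. -/
theorem TraceInequality.mem_tracedSobolev_of_isTrace {C₁ C₂ : ℝ} (hT : TraceInequality Ω C₁ C₂)
    (hΩ : IsBoundedLipschitzDomain Ω) {u : L2 Ω} {G : L2Vec Ω} {g : L2Surf Ω} {g' : E d → ℂ}
    (hG : weakGrad Ω u =ᵐ[vol Ω] G) (hg : g =ᵐ[surf Ω] g') (h : IsTrace Ω u g') :
    (WithLp.toLp 2 (u, WithLp.toLp 2 (G, g)) : TraceTriple Ω) ∈ tracedSobolev Ω := by
  obtain ⟨-, φ, hφ, l1, l2, l3⟩ := h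
  choose q hq h1 h2 h3 using fun n => hT.exists_smoothTriple hΩ (hφ n)
  refine mem_closure_of_tendsto (f := q) (b := atTop) ?_ (Eventually.of_forall hq)
  have t1 : Tendsto (fun n => (q n).fst) atTop (𝓝 u) := by
    refine (Lp.tendsto_Lp_iff_tendsto_eLpNorm' _ _).mpr (l1.congr fun n => eLpNorm_congr_ae ?_)
    filter_upwards [h1 n] with x hx
    simp [hx]
  have t2 : Tendsto (fun n => (q n).snd.fst) atTop (𝓝 G) := by
    refine (Lp.tendsto_Lp_iff_tendsto_eLpNorm' _ _).mpr (l2.congr fun n => eLpNorm_congr_ae ?_)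
    filter_upwards [h2 n, hG] with x hx hx'
    simp [hx, hx']
  have t3 : Tendsto (fun n => (q n).snd.snd) atTop (𝓝 g) := by
    refine (Lp.tendsto_Lp_iff_tendsto_eLpNorm' _ _).mpr (l3.congr fun n => eLpNorm_congr_ae ?_)
    filter_upwards [h3 n, hg] with x hx hx'
    simp [hx, hx']
  have hc : Continuous fun r : L2 Ω × L2Vec Ω × L2Surf Ω =>
      (WithLp.toLp 2 (r.1, WithLp.toLp 2 (r.2.1, r.2.2)) : TraceTriple Ω) := by fun_prop
  exact (hc.tendsto (u, G, g)).comp (t1.prodMk_nhds (t2.prodMk_nhds t3))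

theorem norm_sq_triple (p : TraceTriple Ω) :
    ‖p‖ ^ 2 = ‖p.snd.fst‖ ^ 2 + ‖p.fst‖ ^ 2 + ‖p.snd.snd‖ ^ 2 := by
  rw [WithLp.prod_norm_sq_eq_of_L2, WithLp.prod_norm_sq_eq_of_L2]
  ring

/-- The trace component is controlled by the other two, so the norm of a triple is equivalent to the
usual `H¹` norm. -/
theorem TraceInequality.norm_sq_le {C₁ C₂ : ℝ} (hC₁ : 0 ≤ C₁) (hC₂ : 0 ≤ C₂)
    (hT : TraceInequality Ω C₁ C₂) {p : TraceTriple Ω} (hp : p ∈ tracedSobolev Ω) :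
    ‖p‖ ^ 2 ≤ (1 + C₁ + C₂) * (‖p.snd.fst‖ ^ 2 + ‖p.fst‖ ^ 2) := by
  have h := hT.norm_trace_sq_le hC₁ hC₂ hp
  rw [norm_sq_triple]
  have h1 : ‖p.snd.fst‖ * ‖p.fst‖ ≤ ‖p.snd.fst‖ ^ 2 + ‖p.fst‖ ^ 2 := by
    nlinarith [sq_nonneg (‖p.snd.fst‖ - ‖p.fst‖), sq_nonneg ‖p.snd.fst‖, sq_nonneg ‖p.fst‖]
  have h2 := mul_le_mul_of_nonneg_left h1 hC₁
  have h3 : C₂ * ‖p.fst‖ ^ 2 ≤ C₂ * (‖p.snd.fst‖ ^ 2 + ‖p.fst‖ ^ 2) := by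
    gcongr
    nlinarith [sq_nonneg ‖p.snd.fst‖]
  linarith

/-- Every `u ∈ H¹(Ω)` comes from the Hilbert space, i.e. has a trace. -/
theorem TraceInequality.exists_mem_tracedSobolev {C₁ C₂ : ℝ} (hC₁ : 0 ≤ C₁) (hC₂ : 0 ≤ C₂)
    (hT : TraceInequality Ω C₁ C₂) (hΩ : IsBoundedLipschitzDomain Ω) {u : L2 Ω} (hu : u ∈ H1 Ω) :
    ∃ p ∈ tracedSobolev Ω, p.fst = u := by
  have hw := MemH1.isWeakGrad_weakGrad hu
  set G : L2Vec Ω := hw.1.toLp (weakGrad Ω u) with hG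
  let P : TraceTriple Ω →L[ℂ] L2 Ω × L2Vec Ω :=
    (WithLp.fstL 2 ℂ _ _).prod ((WithLp.fstL 2 ℂ _ _).comp (WithLp.sndL 2 ℂ _ _))
  have hP : ∀ p, P p = (p.fst, p.snd.fst) := fun p => rfl
  let Q : tracedSobolev Ω →L[ℂ] L2 Ω × L2Vec Ω := P.comp (tracedSobolev Ω).subtypeL
  -- Forgetting the trace is bounded below, so the pairs `(u, ∇u)` coming from the complete space
  -- form a closed set. By density of `C¹` functions it contains every pair with `u ∈ H¹(Ω)`.
  have hanti : AntilipschitzWith (√(2 * (1 + C₁ + C₂))).toNNReal Q := by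
    refine Q.antilipschitz_of_bound fun p => ?_
    rw [Real.coe_toNNReal _ (Real.sqrt_nonneg _), ← sq_le_sq₀ (norm_nonneg _) (by positivity),
      mul_pow, Real.sq_sqrt (by positivity)]
    refine (hT.norm_sq_le hC₁ hC₂ p.2).trans ?_
    have h1 : ‖(p : TraceTriple Ω).fst‖ ≤ ‖Q p‖ := norm_fst_le (Q p)
    have h2 : ‖(p : TraceTriple Ω).snd.fst‖ ≤ ‖Q p‖ := norm_snd_le (Q p)
    have h3 : ‖(p : TraceTriple Ω).snd.fst‖ ^ 2 + ‖(p : TraceTriple Ω).fst‖ ^ 2 ≤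
        2 * ‖Q p‖ ^ 2 := by
      have := pow_le_pow_left₀ (norm_nonneg _) h1 2
      have := pow_le_pow_left₀ (norm_nonneg _) h2 2
      linarith
    calc _ ≤ (1 + C₁ + C₂) * (2 * ‖Q p‖ ^ 2) := by gcongr
      _ = _ := by ring
  have hclosed := hanti.isClosed_range Q.uniformContinuous
  have hmem : ((u, G) : L2 Ω × L2Vec Ω) ∈ closure (Set.range Q) := by
    refine EMetric.mem_closure_iff.mpr fun ε hε => ?_
    obtain ⟨ε', hε', hlt⟩ := exists_between hε
    obtain ⟨φ, hφ, h1, h2⟩ := exists_contDiff_approx hΩ (Lp.memLp u) hw hε'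
    obtain ⟨p, hp, k1, k2, -⟩ := hT.exists_smoothTriple hΩ hφ
    refine ⟨Q ⟨p, subset_closure hp⟩, ⟨_, rfl⟩, lt_of_le_of_lt ?_ hlt⟩
    change edist (u, G) (p.fst, p.snd.fst) ≤ ε'
    rw [edist_comm, Prod.edist_eq]
    refine max_le ?_ ?_
    · rw [Lp.edist_def]
      refine le_trans (le_of_eq (eLpNorm_congr_ae ?_)) h1
      filter_upwards [k1] with x hx
      simp [hx]
    · rw [Lp.edist_def]
      refine le_trans (le_of_eq (eLpNorm_congr_ae ?_)) h2
      filter_upwards [k2, hw.1.coeFn_toLp] with x hx hx'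
      simp [hx, hG, hx']
  rw [hclosed.closure_eq] at hmem
  obtain ⟨p, hp⟩ := hmem
  exact ⟨p, p.2, congrArg Prod.fst hp⟩

/-- Two triples with the same function and gradient differ by a triple with only a boundary
component, which the trace inequality forces to vanish. -/
theorem TraceInequality.trace_ae_eq {C₁ C₂ : ℝ} (hC₁ : 0 ≤ C₁) (hC₂ : 0 ≤ C₂)
    (hT : TraceInequality Ω C₁ C₂) (hΩ : IsBoundedLipschitzDomain Ω) {p : TraceTriple Ω}
    (hp : p ∈ tracedSobolev Ω) : trace Ω p.fst =ᵐ[surf Ω] p.snd.snd := by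
  have htr : IsTrace Ω p.fst (trace Ω p.fst) :=
    Classical.epsilon_spec ⟨_, isTrace_of_mem_tracedSobolev hΩ hp⟩
  have hq := hT.mem_tracedSobolev_of_isTrace hΩ (weakGrad_ae_eq hΩ hp) htr.1.coeFn_toLp htr
  have h := hT.norm_trace_sq_le hC₁ hC₂ (Submodule.sub_mem _ hq hp)
  have h1 : ‖htr.1.toLp (trace Ω p.fst) - p.snd.snd‖ ^ 2 ≤ 0 := by simpa using h
  have h2 : htr.1.toLp (trace Ω p.fst) - p.snd.snd = 0 :=
    norm_eq_zero.mp (pow_eq_zero_iff two_ne_zero |>.mp (le_antisymm h1 (sq_nonneg _)))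
  have h3 := htr.1.coeFn_toLp
  rw [sub_eq_zero.mp h2] at h3
  exact h3.symm

theorem TraceInequality.robinForm_eq {C₁ C₂ : ℝ} (hC₁ : 0 ≤ C₁) (hC₂ : 0 ≤ C₂)
    (hT : TraceInequality Ω C₁ C₂) (hΩ : IsBoundedLipschitzDomain Ω) (α : ℂ) {p q : TraceTriple Ω}
    (hp : p ∈ tracedSobolev Ω) (hq : q ∈ tracedSobolev Ω) :
    robinForm Ω α p.fst q.fst =
      inner ℂ q.snd.fst p.snd.fst + α * inner ℂ q.snd.snd p.snd.snd := by
  rw [robinForm, L2.inner_def, L2.inner_def, ← integral_const_mul]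
  congr 1
  · refine integral_congr_ae ?_
    filter_upwards [weakGrad_ae_eq hΩ hp, weakGrad_ae_eq hΩ hq] with x h1 h2
    rw [h1, h2]
  · refine integral_congr_ae ?_
    filter_upwards [hT.trace_ae_eq hC₁ hC₂ hΩ hp, hT.trace_ae_eq hC₁ hC₂ hΩ hq] with x h1 h2
    rw [h1, h2, RCLike.inner_apply, mul_assoc]

end TracedSobolev

/-! ### Numerical range and spectrum of the Robin Laplacian -/

section Robin

variable {d : ℕ} {Ω : Set (E d)} {C₁ C₂ : ℝ}

theorem TraceInequality.robinNumericalRange_subset (hC₁ : 0 ≤ C₁) (hC₂ : 0 ≤ C₂)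
    (hT : TraceInequality Ω C₁ C₂) (hΩ : IsBoundedLipschitzDomain Ω) (α : ℂ) :
    robinNumericalRange Ω α ⊆ parabolicRegion C₁ C₂ α := by
  rintro _ ⟨u, hu, hu1, rfl⟩
  obtain ⟨p, hp, rfl⟩ := hT.exists_mem_tracedSobolev hC₁ hC₂ hΩ hu
  have h := hT.norm_trace_sq_le hC₁ hC₂ hp
  rw [hu1] at h
  refine ⟨‖p.snd.fst‖ ^ 2, ‖p.snd.snd‖ ^ 2, sq_nonneg _, sq_nonneg _, ?_, ?_⟩
  · rw [Real.sqrt_sq (norm_nonneg _)]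
    linarith
  · rw [hT.robinForm_eq hC₁ hC₂ hΩ α hp hp, inner_self_eq_norm_sq_to_K, inner_self_eq_norm_sq_to_K]
    push_cast
    rfl

/-- Solvability of the variational problem with form `⟨D p, D q⟩ + α ⟨T p, T q⟩`. -/
theorem exists_resolvent_of_coercive {V H H₁ H₂ : Type*} [NormedAddCommGroup V]
    [InnerProductSpace ℂ V] [CompleteSpace V] [NormedAddCommGroup H] [InnerProductSpace ℂ H]
    [CompleteSpace H] [NormedAddCommGroup H₁] [InnerProductSpace ℂ H₁] [CompleteSpace H₁]
    [NormedAddCommGroup H₂] [InnerProductSpace ℂ H₂] [CompleteSpace H₂] (J : V →L[ℂ] H)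
    (D : V →L[ℂ] H₁) (T : V →L[ℂ] H₂) (α z : ℂ) {c : ℝ} (hc : 0 < c)
    (hcoer : ∀ p, c * (‖p‖ * ‖p‖) ≤
      ‖D p‖ * ‖D p‖ + α.re * (‖T p‖ * ‖T p‖) - z.re * (‖J p‖ * ‖J p‖)) :
    ∃ R : H →L[ℂ] H, ∀ u f, (∃ p, J p = u ∧
      ∀ q, inner ℂ (D q) (D p) + α * inner ℂ (T q) (T p) = inner ℂ (J q) (f + z • u)) ↔
        u = R f := by
  -- `A` represents the form shifted by `z` on `V`; once it is invertible, the resolvent is `J A⁻¹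
  -- J*`.
  let A : V →L[ℂ] V := D.adjoint.comp D + α • T.adjoint.comp T - z • J.adjoint.comp J
  have hA : ∀ q p, inner ℂ q (A p) =
      inner ℂ (D q) (D p) + α * inner ℂ (T q) (T p) - z * inner ℂ (J q) (J p) := by
    intro q p
    simp only [A, sub_apply, add_apply,
      smul_apply, ContinuousLinearMap.comp_apply, inner_sub_right,
      inner_add_right, inner_smul_right, ContinuousLinearMap.adjoint_inner_right]
  obtain ⟨e, he⟩ := exists_equiv_of_coercive (A := A) hc fun p => by
    rw [sq]
    refine (hcoer p).trans_eq ?_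
    rw [hA, inner_self_eq_norm_sq_to_K, inner_self_eq_norm_sq_to_K, inner_self_eq_norm_sq_to_K]
    simp [sq]
  have heA : ∀ p, e p = A p := fun p => by rw [← he]; rfl
  refine ⟨(J.comp (e.symm : V →L[ℂ] V)).comp J.adjoint, fun u f => ⟨?_, fun hu => ?_⟩⟩
  · rintro ⟨p, rfl, hv⟩
    have h1 : A p = J.adjoint f := by
      refine ext_inner_left ℂ fun q => ?_
      have h2 := hv q
      rw [inner_add_right, inner_smul_right] at h2
      rw [hA, ContinuousLinearMap.adjoint_inner_right, h2]
      ring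
    have h3 : p = e.symm (J.adjoint f) := by rw [← h1, ← heA, e.symm_apply_apply]
    exact congrArg J h3
  · refine ⟨e.symm (J.adjoint f), hu.symm, fun q => ?_⟩
    have h1 : A (e.symm (J.adjoint f)) = J.adjoint f := by rw [← heA, e.apply_symm_apply]
    have h2 := hA q (e.symm (J.adjoint f))
    rw [h1, ContinuousLinearMap.adjoint_inner_right] at h2
    have h3 : u = J (e.symm (J.adjoint f)) := hu
    rw [inner_add_right, inner_smul_right, h2, h3]
    ring

/-- The embedding of `H¹(Ω)` into `L²(Ω)`. -/
def embeddingOp (Ω : Set (E d)) : tracedSobolev Ω →L[ℂ] L2 Ω :=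
  (WithLp.fstL 2 ℂ _ _).comp (tracedSobolev Ω).subtypeL

/-- The gradient as an operator from `H¹(Ω)` to `L²(Ω; ℂᵈ)`. -/
def gradOp (Ω : Set (E d)) : tracedSobolev Ω →L[ℂ] L2Vec Ω :=
  ((WithLp.fstL 2 ℂ _ _).comp (WithLp.sndL 2 ℂ _ _)).comp (tracedSobolev Ω).subtypeL

/-- The trace as an operator from `H¹(Ω)` to `L²(∂Ω)`. -/
def traceOp (Ω : Set (E d)) : tracedSobolev Ω →L[ℂ] L2Surf Ω :=
  ((WithLp.sndL 2 ℂ _ _).comp (WithLp.sndL 2 ℂ _ _)).comp (tracedSobolev Ω).subtypeL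

/-- Coercivity concerns the real part of the shifted form, so only `α.re` and `z.re` matter. The
trace inequality bounds the boundary term by a quadratic form in `‖D p‖` and `‖J p‖`, and `hz` is
the condition for positive definiteness. -/
theorem TraceInequality.mem_graphResolventSet (hC₁ : 0 ≤ C₁) (hC₂ : 0 ≤ C₂)
    (hT : TraceInequality Ω C₁ C₂) (hΩ : IsBoundedLipschitzDomain Ω) {α z : ℂ}
    (hz : z.re < -(C₁ ^ 2 / 4) * |α.re| ^ 2 - C₂ * |α.re|) :
    z ∈ graphResolventSet (formOperatorGraph (H1 Ω) (robinForm Ω α)) := by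
  set J := embeddingOp Ω
  set D := gradOp Ω
  set T := traceOp Ω
  have hform : ∀ p q, robinForm Ω α (J p) (J q) =
      inner ℂ (D q) (D p) + α * inner ℂ (T q) (T p) := fun p q =>
    hT.robinForm_eq hC₁ hC₂ hΩ α p.2 q.2
  have hJ1 : ∀ p, J p ∈ H1 Ω := fun p => memH1_of_mem_tracedSobolev hΩ p.2
  have hJ : ∀ u ∈ H1 Ω, ∃ p, J p = u := fun u hu => by
    obtain ⟨p, hp, hpu⟩ := hT.exists_mem_tracedSobolev hC₁ hC₂ hΩ hu
    exact ⟨⟨p, hp⟩, hpu⟩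
  obtain ⟨c, hc, hquad⟩ := exists_pos_quadratic_lower_bound (C₁ := C₁) (C₂ := C₂) (a := |α.re|)
    (w := -z.re) (by linarith)
  -- Dividing by `1 + C₁ + C₂` passes from `‖D p‖² + ‖J p‖²` to the full norm of the triple.
  have hcoer : ∀ p : tracedSobolev Ω, c / (1 + C₁ + C₂) * (‖p‖ * ‖p‖) ≤
      ‖D p‖ * ‖D p‖ + α.re * (‖T p‖ * ‖T p‖) - z.re * (‖J p‖ * ‖J p‖) := by
    intro p
    simp only [← sq]
    have h1 := hT.norm_sq_le hC₁ hC₂ p.2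
    have h2 := hT.norm_trace_sq_le hC₁ hC₂ p.2
    have h3 := hquad ‖D p‖ ‖J p‖
    have h5 : -(|α.re| * ‖T p‖ ^ 2) ≤ α.re * ‖T p‖ ^ 2 := by
      rw [← neg_mul]
      exact mul_le_mul_of_nonneg_right (neg_abs_le _) (sq_nonneg _)
    have h6 : |α.re| * ‖T p‖ ^ 2 ≤ |α.re| * (C₁ * (‖D p‖ * ‖J p‖) + C₂ * ‖J p‖ ^ 2) :=
      mul_le_mul_of_nonneg_left h2 (abs_nonneg _)
    have h7 : c / (1 + C₁ + C₂) * ‖p‖ ^ 2 ≤ c * (‖D p‖ ^ 2 + ‖J p‖ ^ 2) := by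
      rw [div_mul_eq_mul_div, div_le_iff₀ (by positivity), mul_assoc]
      refine mul_le_mul_of_nonneg_left ?_ hc.le
      rw [mul_comm]
      exact h1
    linarith
  obtain ⟨R, hR⟩ := exists_resolvent_of_coercive (V := tracedSobolev Ω) J D T α z
    (c := c / (1 + C₁ + C₂)) (by positivity) (fun p => by have h := hcoer p; exact h)
  refine ⟨R, fun u f => Iff.trans ⟨?_, ?_⟩ (hR u f)⟩
  · rintro ⟨hu, hv⟩
    obtain ⟨p, rfl⟩ := hJ u hu
    exact ⟨p, rfl, fun q => (hform p q).symm.trans (hv (J q) (hJ1 q))⟩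
  · rintro ⟨p, rfl, hq⟩
    refine ⟨hJ1 p, fun v hv => ?_⟩
    obtain ⟨q, rfl⟩ := hJ v hv
    exact (hform p q).trans (hq q)

end Robin

end RobinRange

end

theorem theorem6p1 (d : ℕ) (hd : 2 ≤ d) (Ω : Set (RobinRange.E d))
    (hΩ : RobinRange.IsBoundedLipschitzDomain Ω) :
    ∃ C₁ C₂ : ℝ, 2 ≤ C₁ ∧ 0 < C₂ ∧ (RobinRange.HasC2Boundary Ω → C₁ = 2) ∧
      ∀ α : ℂ,
        RobinRange.robinNumericalRange Ω α ⊆ RobinRange.parabolicRegion C₁ C₂ α ∧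
        ∀ z ∈ RobinRange.robinSpectrum Ω α,
          z.re ≥ -(C₁ ^ 2 / 4) * |α.re| ^ 2 - C₂ * |α.re| := by
  obtain ⟨C₁, C₂, h1, h2, h3, hT⟩ := RobinRange.exists_traceInequality hΩ
  have hC₁ : 0 ≤ C₁ := zero_le_two.trans h1
  refine ⟨C₁, C₂, h1, h2, h3, fun α =>
    ⟨hT.robinNumericalRange_subset hC₁ h2.le hΩ α, fun z hz => ?_⟩⟩
  by_contra h
  exact hz (hT.mem_graphResolventSet hC₁ h2.le hΩ (not_le.mp h))
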